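/- Let $d\ge 2$, $h>0$, $p>1$, and $g(x)=(x^+)^p-x$ for $x\in\mathbb R$, where $x^+=\max(x,0)$. Let $b:\mathbb R^d\to\mathbb R^d$ be the vector field $$b_1(U)=\tfrac{2}{h^2}(-U_1+U_2),\qquad b_i(U)=\tfrac1{h^2}(U_{i+1}-2U_i+U_{i-1})\ (2\le i\le d-1),\qquad b_d(U)=\tfrac2{h^2}\bigl(-U_d+U_{d-1}+h\,g(U_d)\bigr).$$ Let $(\Omega,\mathcal F,P)$ be a probability space with a filtration $(\mathcal F_t)_{t\ge0}$ satisfying the usual conditions, and let $W$ be a standard $d$-dimensional $(\mathcal F_t)$-Brownian motion. For $\varepsilon>0$ and $u\in\mathbb R^d$, a solution up to an explosion time of $$dU=b(U)\,dt+\varepsilon\,dW,\qquad U(0)=u, \tag{1}$$ is an $(\mathcal F_t)$-adapted process $U$ with almost surely continuous paths in the one-point compactification $\mathbb R^d\cup\{\infty\}$ such that, with $\tau^n=\inf\{t\ge0:|U(t)|\ge n\}$ (where $|\infty|=\infty$ and $\inf\emptyset=\infty$) and $\tau_\varepsilon=\lim_{n\to\infty}\tau^n$, * for every $n\in\mathbb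 N$ and $t\ge 0$, almost surely $\int_0^{t\wedge\tau^n}|b(U(s))|\,ds<\infty$, and for every $n\in\mathbb N$, almost surely $U(t\wedge\tau^n)=u+\int_0^{t\wedge\tau^n}b(U(s))\,ds+\varepsilon W(t\wedge\tau^n)$ for all $t\ge0$; * almost surely, $U(t)=\infty$ for all finite $t\ge\tau_\varepsilon$. Theorem. For every $\varepsilon>0$, every initial condition $u\in\mathbb R^d$ and every solution $U$ of (1) up to an explosion time, the explosion time is almost surely finite: $P(\tau_\varepsilon<\infty)=1$. By contrast, the deterministic system $U'=b(U)$ (the case $\varepsilon=0$) has a solution defined on all of $[0,\infty)$ for at least one initial condition. -/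

import Mathlib

open MeasureTheory ProbabilityTheory
open scoped NNReal ENNReal

noncomputable section

namespace BlowUpSDE

/-- The state space `ℝ^d` with its Euclidean norm. -/
abbrev State (d : ℕ) : Type := EuclideanSpace ℝ (Fin d)

/-! ### The drift of the discretized reaction-diffusion equation -/

/-- The reaction term `g(x) = (x⁺)^p - x`. -/
def reaction (p x : ℝ) : ℝ := (max x 0) ^ p - x

/-- The coordinate of `x` with (zero-based) index `k`; the value `0` for `k ≥ d` is never used by
`drift` when `d ≥ 2`. -/
def node {d : ℕ} (x : State d) (k : ℕ) : ℝ := if hk : k < d then x ⟨k, hk⟩ else 0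

/-- The vector field `b` of the system. With zero-based indices `i = 0, …, d - 1`,
* `b_0(x) = (2 / h²) (-x_0 + x_1)`,
* `b_i(x) = (1 / h²) (x_{i+1} - 2 x_i + x_{i-1})` for `0 < i < d - 1`,
* `b_{d-1}(x) = (2 / h²) (-x_{d-1} + x_{d-2} + h g(x_{d-1}))`. -/
def drift (d : ℕ) (h p : ℝ) (x : State d) : State d :=
  WithLp.toLp 2 fun i : Fin d =>
    if (i : ℕ) = 0 then
      2 / h ^ 2 * (-x i + node x 1)
    else if (i : ℕ) + 1 = d then
      2 / h ^ 2 * (-x i + node x (i - 1) + h * reaction p (x i))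
    else
      1 / h ^ 2 * (node x (i + 1) - 2 * x i + node x (i - 1))

/-- `U` is a solution of the autonomous ODE `U' = b(U)` on all of `[0, ∞)`
(one-sided derivative at time `0`). -/
def IsGlobalODESolution {d : ℕ} (b : State d → State d) (U : ℝ → State d) : Prop :=
  ∀ t : ℝ, 0 ≤ t → HasDerivWithinAt U (b (U t)) (Set.Ici 0) t

/-! ### Filtrations and Brownian motion -/

/-- The usual conditions: the filtration is right-continuous and its initial σ-algebra contains
all `P`-null sets (in particular `P` is complete). -/
structure UsualConditions {Ω : Type*} {m : MeasurableSpace Ω} (F : Filtration ℝ≥0 m)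
    (P : Measure Ω) : Prop where
  rightContinuous : F.IsRightContinuous
  complete : ∀ s : Set Ω, P s = 0 → MeasurableSet[F 0] s

/-- `W` is a `d`-dimensional standard Brownian motion relative to the filtration `F`: its
coordinates are independent standard real Brownian motions, it is adapted to `F`, and its
increments after time `s` are independent of `F s`. -/
structure IsStandardBrownian {Ω : Type*} {m : MeasurableSpace Ω} {d : ℕ} (F : Filtration ℝ≥0 m)
    (P : Measure Ω) (W : ℝ≥0 → Ω → State d) : Prop where
  adapted : Adapted F W
  coord_isBrownian : ∀ i : Fin d, IsBrownianReal (fun t ω => W t ω i) P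
  coord_indep : iIndepFun (fun (i : Fin d) (ω : Ω) (t : ℝ≥0) => W t ω i) P
  increment_indep : ∀ s t : ℝ≥0, s ≤ t →
    Indep (MeasurableSpace.comap (fun ω => W t ω - W s ω) inferInstance) (F s) P

/-! ### Solutions up to an explosion time -/

/-- `exitTime X n ω = inf {t ≥ 0 : |X(t)| ≥ n}`, where `|∞| = ∞` and `inf ∅ = ∞`. -/
def exitTime {Ω : Type*} {d : ℕ} (X : ℝ≥0 → Ω → OnePoint (State d)) (n : ℕ) (ω : Ω) : ℝ≥0∞ :=
  ⨅ (t : ℝ≥0) (_ : ∀ x : State d, X t ω = (x : OnePoint (State d)) → (n : ℝ) ≤ ‖x‖), (t : ℝ≥0∞)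

/-- The explosion time: the limit (supremum) of the nondecreasing sequence of exit times. -/
def explosionTime {Ω : Type*} {d : ℕ} (X : ℝ≥0 → Ω → OnePoint (State d)) (ω : Ω) : ℝ≥0∞ :=
  ⨆ n : ℕ, exitTime X n ω

/-- The time `min t (exitTime X n ω)`, as a (finite) nonnegative real number. -/
def localizedTime {Ω : Type*} {d : ℕ} (X : ℝ≥0 → Ω → OnePoint (State d)) (n : ℕ) (t : ℝ≥0)
    (ω : Ω) : ℝ≥0 :=
  (min (t : ℝ≥0∞) (exitTime X n ω)).toNNReal

/-- A point of `ℝ^d ∪ {∞}` read in `ℝ^d`; the value at `∞` is irrelevant, since it is used only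
at times before an exit time, when the process is finite. -/
def finitePart {d : ℕ} (x : OnePoint (State d)) : State d := x.elim 0 id

/-- `X` is a solution up to an explosion time of `dX = b(X) dt + ε dW`, `X(0) = u`, on the
probability space `(Ω, P)` with respect to the filtration `F` and the Brownian motion `W`.
It takes values in the one-point compactification `ℝ^d ∪ {∞}`, is adapted, has continuous paths
almost surely, satisfies the integral equation up to each exit time, and
stays at `∞` from the explosion time on. (The strong Markov property, being a consequence, is not
required.) -/
structure IsSolutionUpToExplosion {Ω : Type*} {m : MeasurableSpace Ω} {d : ℕ}
    (F : Filtration ℝ≥0 m) (P : Measure Ω) (W : ℝ≥0 → Ω → State d)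
    (b : State d → State d) (ε : ℝ) (u : State d)
    (X : ℝ≥0 → Ω → OnePoint (State d)) : Prop where
  adapted : ∀ t : ℝ≥0, Measurable[F t, borel (OnePoint (State d))] (X t)
  continuous_paths : ∀ᵐ ω ∂P, Continuous fun t : ℝ≥0 => X t ω
  drift_integrable : ∀ (n : ℕ) (t : ℝ≥0), ∀ᵐ ω ∂P,
    IntervalIntegrable (fun s : ℝ => b (finitePart (X s.toNNReal ω))) volume
      0 (localizedTime X n t ω)
  integral_eq : ∀ n : ℕ, ∀ᵐ ω ∂P, ∀ t : ℝ≥0,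
    X (localizedTime X n t ω) ω =
      ((u + (∫ s in (0 : ℝ)..(localizedTime X n t ω), b (finitePart (X s.toNNReal ω)))
        + ε • W (localizedTime X n t ω) ω : State d) : OnePoint (State d))
  absorbed : ∀ᵐ ω ∂P, ∀ t : ℝ≥0, explosionTime X ω ≤ t → X t ω = OnePoint.infty

end BlowUpSDE

end

/-!
The deterministic system has the constant solution `0`, so only almost sure explosion needs an
argument. It avoids stochastic calculus: the noise is additive, so that along a path which does not
explode the function `x - ε w` is differentiable with derivative `b(x)`, and everything about the
solution follows from deterministic comparison on short time windows `[s, s + σ²]`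
(`IsDrivenPath.barrier`), the coordinates of `b` being nondecreasing in the other coordinates.
There are three such comparisons.

* Since `g(x) ≥ -x`, the deficit of the path (how far its coordinates lie below `0`) contracts by a
  fixed factor over a window, up to the oscillation of the noise (`exists_contraction`). This uses a
  concave supersolution of the discrete Laplacian with its Neumann and Robin boundary conditions.
* Since also `g ≥ -1`, all coordinates lose at most a multiple of the length of the window besides
  what the noise does (`IsDrivenPath.sub_mul_add_le`).
* If all coordinates start high enough, the superlinear term makes the last one blow up within the
  window (`exists_blowup_level`).

Call a window good if all coordinates of `W` gain at least `σ` while `W` oscillates by at most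
`lam * σ`. By Brownian scaling, for a suitable `lam` the conditional probability of a good window
given the past has a positive lower bound `q` not depending on `σ`
(`IsStandardBrownian.exists_le_measure_goodWindow`). The loss through the drift over a good window
is of order `σ²` and the gain is of order `σ`; so for `σ` small each good window lifts the path by a
fixed amount, and a path which starts a long enough run of good windows with deficit at most `R`
explodes. The length of this run depends on `R` only.

It remains to see that such runs occur. Iterating the contraction bounds the deficit by a random
sequence whose expectation is bounded uniformly in time, and `ae_mem_of_trials` concludes: a
sequence of trials with conditional success probability bounded below, started from tight
data, succeeds almost surely.

The oscillation of `W` on a window is controlled by a sum of fourth moments of dyadic increments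
(`chainingBound`). Only the independence of single increments from the past enters, and never the
joint law of a whole path.
-/

namespace BlowUpSDE

open Set Filter Topology

/-! ### Dyadic chaining -/

/-- If the increments of a continuous function over the dyadic intervals of level `n` are at most
`M n`, the oscillation on `[0, 1]` is at most `∑ M n`: a point is reached from `0` through its
dyadic lower approximations, using at most one dyadic increment of each level. -/
theorem edist_le_tsum_of_dyadic {E : Type*} [PseudoEMetricSpace E] {g : ℝ≥0 → E}
    (hg : Continuous g) (M : ℕ → ℝ≥0∞)
    (hM : ∀ n k : ℕ, k < 2 ^ n → edist (g (k / 2 ^ n)) (g ((k + 1) / 2 ^ n)) ≤ M n)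
    {y : ℝ≥0} (hy : y ≤ 1) : edist (g 0) (g y) ≤ ∑' n, M n := by
  have step : ∀ n : ℕ, edist (g 0) (g ((⌊y * 2 ^ n⌋₊ : ℝ≥0) / 2 ^ n)) ≤
      ∑ m ∈ Finset.range (n + 1), M m := by
    intro n
    induction n with
    | zero =>
      rcases hy.lt_or_eq with h | h
      · have : ⌊y⌋₊ = 0 := Nat.floor_eq_zero.2 h
        simp [this]
      · have := hM 0 0 (by norm_num)
        simpa [h] using this
    | succ n ih =>
      rw [Finset.sum_range_succ]
      refine (edist_triangle _ (g ((⌊y * 2 ^ n⌋₊ : ℝ≥0) / 2 ^ n)) _).trans (add_le_add ih ?_)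
      set a := ⌊y * 2 ^ n⌋₊ with ha
      have h1 : (a : ℝ≥0) ≤ y * 2 ^ n := Nat.floor_le zero_le
      have h2 : y * 2 ^ n < a + 1 := Nat.lt_floor_add_one _
      have h3 : y * 2 ^ (n + 1) = 2 * (y * 2 ^ n) := by ring
      have e0 : (a : ℝ≥0) / 2 ^ n = ((2 * a : ℕ) : ℝ≥0) / 2 ^ (n + 1) := by
        push_cast
        rw [pow_succ, mul_comm (2 : ℝ≥0) (a : ℝ≥0), mul_div_mul_right _ _ (by norm_num)]
      have hcase : ⌊y * 2 ^ (n + 1)⌋₊ = 2 * a ∨ ⌊y * 2 ^ (n + 1)⌋₊ = 2 * a + 1 := by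
        have l1 : 2 * a ≤ ⌊y * 2 ^ (n + 1)⌋₊ := by
          rw [h3]; apply Nat.le_floor; push_cast; gcongr
        have l2 : ⌊y * 2 ^ (n + 1)⌋₊ < 2 * a + 2 := by
          rw [h3, Nat.floor_lt zero_le]; push_cast
          calc 2 * (y * 2 ^ n) < 2 * (a + 1) := by gcongr
            _ = 2 * a + 2 := by ring
        omega
      rcases hcase with h | h
      · rw [h, ← e0]; simp
      · rw [h, e0]
        have hlt : 2 * a < 2 ^ (n + 1) := by
          have l3 : ⌊y * 2 ^ (n + 1)⌋₊ ≤ 2 ^ (n + 1) := by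
            apply Nat.floor_le_of_le
            push_cast
            exact mul_le_of_le_one_left zero_le hy
          omega
        have := hM (n + 1) (2 * a) hlt
        push_cast at this ⊢
        exact this
  have hlim : Tendsto (fun n : ℕ => ((⌊y * 2 ^ n⌋₊ : ℝ≥0) / 2 ^ n)) atTop (𝓝 y) := by
    have h2 : Tendsto (fun n : ℕ => (2 : ℝ) ^ n) atTop atTop :=
      tendsto_pow_atTop_atTop_of_one_lt (by norm_num)
    have := (tendsto_nat_floor_mul_div_atTop (R := ℝ) (a := y) y.2).comp h2
    rw [← NNReal.tendsto_coe]
    refine this.congr fun n => ?_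
    simp only [Function.comp]
    push_cast
    congr 2
  refine le_of_tendsto (tendsto_const_nhds.edist ((hg.tendsto y).comp hlim)) ?_
  exact Eventually.of_forall fun n => (step n).trans (ENNReal.sum_le_tsum _)

/-! ### A barrier principle -/

/-- A finite family of functions which starts nonnegative stays nonnegative if, whenever all of
them are nonnegative, those that vanish have a positive right derivative. -/
theorem nonneg_of_pos_deriv_at_zero {ι : Type*} [Finite ι] {f f' : ι → ℝ → ℝ} {a b : ℝ}
    (hf : ∀ i, ContinuousOn (f i) (Icc a b))
    (hd : ∀ i, ∀ t ∈ Ico a b, HasDerivWithinAt (f i) (f' i t) (Ici t) t)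
    (h0 : ∀ i, 0 ≤ f i a)
    (hpos : ∀ t ∈ Ico a b, (∀ j, 0 ≤ f j t) → ∀ i, f i t = 0 → 0 < f' i t) :
    ∀ t ∈ Icc a b, ∀ i, 0 ≤ f i t := by
  have hclosed : IsClosed ({t | ∀ i, 0 ≤ f i t} ∩ Icc a b) := by
    have : {t | ∀ i, 0 ≤ f i t} ∩ Icc a b = Icc a b ∩ ⋂ i, (Icc a b ∩ f i ⁻¹' Ici 0) := by
      ext t
      simp only [mem_inter_iff, mem_ofPred_eq, mem_iInter, mem_preimage, mem_Ici]
      grind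
    rw [this]
    exact isClosed_Icc.inter (isClosed_iInter fun i =>
      (hf i).preimage_isClosed_of_isClosed isClosed_Icc isClosed_Ici)
  refine hclosed.Icc_subset_of_forall_mem_nhdsWithin h0 ?_
  rintro t ⟨ht, htab⟩
  have hev : ∀ i, ∀ᶠ r in 𝓝[>] t, 0 ≤ f i r := by
    intro i
    rcases (ht i).lt_or_eq with h | h
    · have hc : ContinuousWithinAt (f i) (Ioi t) t :=
        (hd i t htab).continuousWithinAt.mono Ioi_subset_Ici_self
      exact (hc.eventually (lt_mem_nhds h)).mono fun r hr => le_of_lt hr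
    · have hp := hpos t htab ht i h.symm
      have hs := (hasDerivWithinAt_iff_tendsto_slope' (lt_irrefl t)).1
        ((hd i t htab).mono Ioi_subset_Ici_self)
      filter_upwards [hs.eventually (lt_mem_nhds hp), self_mem_nhdsWithin] with r hr hrt
      rw [slope_def_field, ← h, sub_zero] at hr
      exact ((div_pos_iff_of_pos_right (sub_pos.2 hrt)).1 hr).le
  exact eventually_all.2 hev

/-! ### Bounds for the drift -/

lemma neg_le_reaction (p x : ℝ) : -x ≤ reaction p x := by
  have := Real.rpow_nonneg (le_max_right x 0) p
  unfold reaction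
  linarith

lemma neg_one_le_reaction {p : ℝ} (hp : 1 < p) (x : ℝ) : -1 ≤ reaction p x := by
  rcases le_total x 1 with h | h
  · linarith [neg_le_reaction p x]
  · have := Real.self_le_rpow_of_one_le h hp.le
    unfold reaction
    rw [max_eq_left (by linarith)]
    linarith

lemma node_of_lt {d : ℕ} (x : State d) {k : ℕ} (hk : k < d) : node x k = x ⟨k, hk⟩ := dif_pos hk

lemma drift_first {d : ℕ} (hd : 2 ≤ d) (h p : ℝ) (x : State d) :
    drift d h p x ⟨0, by omega⟩ = 2 / h ^ 2 * (-node x 0 + node x 1) := by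
  simp [drift, node_of_lt x (show 0 < d by omega)]

lemma drift_last {d : ℕ} (hd : 2 ≤ d) (h p : ℝ) (x : State d) :
    drift d h p x ⟨d - 1, by omega⟩ =
      2 / h ^ 2 * (-node x (d - 1) + node x (d - 2) + h * reaction p (node x (d - 1))) := by
  have h1 : d - 1 ≠ 0 := by omega
  have h2 : d - 1 + 1 = d := by omega
  simp [drift, node_of_lt x (show d - 1 < d by omega), h1, h2, Nat.sub_sub]

lemma drift_interior {d : ℕ} (h p : ℝ) (x : State d) {k : ℕ} (h0 : k ≠ 0) (hk : k + 1 < d) :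
    drift d h p x ⟨k, by omega⟩ = 1 / h ^ 2 * (node x (k + 1) - 2 * node x k + node x (k - 1)) := by
  simp [drift, node_of_lt x (show k < d by omega), h0, hk.ne]

/-- A strict supersolution `φ` of the linear part of the drift, the one in which the reaction is
replaced by `-x`: a slightly concave profile with values in `[1/2, 1]`. -/
lemma exists_supersolution {d : ℕ} (hd : 2 ≤ d) {h : ℝ} (hh : 0 < h) :
    ∃ (φ : ℕ → ℝ) (κ : ℝ), 0 < κ ∧ (∀ k < d, 1 / 2 ≤ φ k ∧ φ k ≤ 1) ∧
      κ ≤ 2 / h ^ 2 * (φ 0 - φ 1) ∧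
      (∀ k, k ≠ 0 → κ ≤ 1 / h ^ 2 * (2 * φ k - φ (k + 1) - φ (k - 1))) ∧
      κ ≤ 2 / h ^ 2 * (φ (d - 1) - φ (d - 2) + h * φ (d - 1)) := by
  have hd0 : (2 : ℝ) ≤ d := by exact_mod_cast hd
  set c : ℝ := min (1 / (2 * d ^ 2)) (h / (8 * d)) with hc
  have hc0 : 0 < c := by positivity
  have hc1 : c * d ^ 2 ≤ 1 / 2 := by
    have := min_le_left (1 / (2 * (d : ℝ) ^ 2)) (h / (8 * d))
    rw [← hc, le_div_iff₀ (by positivity)] at this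
    linarith
  have hc2 : c * (2 * d) ≤ h / 4 := by
    have := min_le_right (1 / (2 * (d : ℝ) ^ 2)) (h / (8 * d))
    rw [← hc, le_div_iff₀ (by positivity)] at this
    linarith
  have hφ : ∀ k : ℕ, k < d → 1 / 2 ≤ 1 - c * (k : ℝ) ^ 2 := by
    intro k hk
    have : (k : ℝ) ^ 2 ≤ (d : ℝ) ^ 2 := by gcongr
    nlinarith
  -- Concavity gives `2 c` in the interior and at the first node; `c` is small enough for the Robin
  -- term `h φ` to dominate at the last node.
  refine ⟨fun k => 1 - c * (k : ℝ) ^ 2, min (2 * c / h ^ 2) (h / (2 * h ^ 2)), by positivity,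
    fun k hk => ⟨hφ k hk, ?_⟩, ?_, ?_, ?_⟩
  · have : 0 ≤ c * (k : ℝ) ^ 2 := by positivity
    linarith
  · refine (min_le_left _ _).trans (le_of_eq ?_)
    push_cast
    ring
  · intro k hk
    refine (min_le_left _ _).trans (le_of_eq ?_)
    have : ((k - 1 : ℕ) : ℝ) = k - 1 := by rw [Nat.cast_sub (by omega)]; simp
    simp only [this]
    push_cast
    ring
  · refine (min_le_right _ _).trans ?_
    have e1 : ((d - 1 : ℕ) : ℝ) = d - 1 := by rw [Nat.cast_sub (by omega)]; simp
    have e2 : ((d - 2 : ℕ) : ℝ) = d - 2 := by rw [Nat.cast_sub (by omega)]; simp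
    have := hφ (d - 1) (by omega)
    rw [e1] at this
    simp only [e1, e2]
    rw [show h / (2 * h ^ 2) = 2 / h ^ 2 * (h / 4) by field_simp; norm_num]
    gcongr
    nlinarith

/-- Lower bound for the drift at a point `x` which is above `m - V` in all coordinates and below
`m + V` in the coordinate considered. -/
lemma le_drift_of_const {d : ℕ} (hd : 2 ≤ d) {h p : ℝ} (hh : 0 < h) (hp : 1 < p) {x : State d}
    {m V : ℝ} (hlow : ∀ j, m - V ≤ x j) (i : Fin d) (hup : x i ≤ m + V) :
    -(4 * V / h ^ 2 + 2 / h) ≤ drift d h p x i := by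
  have hn : ∀ k < d, m - V ≤ node x k := fun k hk => by rw [node_of_lt x hk]; exact hlow _
  have hu : node x i ≤ m + V := by rw [node_of_lt x i.2]; exact hup
  have hV : 0 ≤ V := by linarith [hlow i]
  have e1 : 4 * V / h ^ 2 = 2 / h ^ 2 * (2 * V) := by ring
  have e2 : 2 / h = 2 / h ^ 2 * h := by field_simp
  have hpos : 0 < 2 / h ^ 2 := by positivity
  obtain ⟨k, hk⟩ := i
  simp only at hu
  by_cases h0 : k = 0
  · subst h0
    rw [drift_first hd, e1, e2]
    nlinarith [hn 1 (by omega)]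
  by_cases hl : k + 1 = d
  · obtain rfl : k = d - 1 := by omega
    rw [drift_last hd, e1, e2]
    nlinarith [hn (d - 2) (by omega), neg_one_le_reaction hp (node x (d - 1)),
      mul_le_mul_of_nonneg_left (neg_one_le_reaction hp (node x (d - 1))) hh.le]
  · rw [drift_interior h p x h0 (by omega), e1, e2,
      show 1 / h ^ 2 * (node x (k + 1) - 2 * node x k + node x (k - 1)) =
        2 / h ^ 2 * ((node x (k + 1) - 2 * node x k + node x (k - 1)) / 2) by ring]
    nlinarith [hn (k + 1) (by omega), hn (k - 1) (by omega)]

/-- Lower bound for the drift at a point `x` which is above `-Q φ - V` in all coordinates and below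
`-Q φ + V` in the coordinate considered, `φ` being a supersolution. -/
lemma le_drift_of_supersolution {d : ℕ} (hd : 2 ≤ d) {h p : ℝ} (hh : 0 < h)
    {φ : ℕ → ℝ} {κ : ℝ}
    (hfirst : κ ≤ 2 / h ^ 2 * (φ 0 - φ 1))
    (hint : ∀ k, k ≠ 0 → κ ≤ 1 / h ^ 2 * (2 * φ k - φ (k + 1) - φ (k - 1)))
    (hlast : κ ≤ 2 / h ^ 2 * (φ (d - 1) - φ (d - 2) + h * φ (d - 1)))
    {x : State d} {Q V : ℝ} (hQ : 0 ≤ Q) (hlow : ∀ j : Fin d, -(φ j * Q) - V ≤ x j) (i : Fin d)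
    (hup : x i ≤ -(φ i * Q) + V) :
    κ * Q - (4 / h ^ 2 + 2 / h) * V ≤ drift d h p x i := by
  have hn : ∀ k < d, -(φ k * Q) - V ≤ node x k := fun k hk => by
    rw [node_of_lt x hk]; exact hlow ⟨k, hk⟩
  have hu : node x i ≤ -(φ i * Q) + V := by rw [node_of_lt x i.2]; exact hup
  have hV : 0 ≤ V := by linarith [hlow i]
  have e2 : (4 / h ^ 2 + 2 / h) * V = 2 / h ^ 2 * (2 * V + h * V) := by field_simp; ring
  have hpos : 0 < 2 / h ^ 2 := by positivity
  have hhV : 0 ≤ h * V := by positivity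
  obtain ⟨k, hk⟩ := i
  simp only at hu
  rw [e2]
  by_cases h0 : k = 0
  · subst h0
    rw [drift_first hd]
    have h1 := mul_le_mul_of_nonneg_right hfirst hQ
    have h2 := mul_le_mul_of_nonneg_left
      (show (φ 0 - φ 1) * Q - (2 * V + h * V) ≤ -node x 0 + node x 1 by
        nlinarith [hn 1 (by omega)]) hpos.le
    nlinarith
  by_cases hl : k + 1 = d
  · obtain rfl : k = d - 1 := by omega
    rw [drift_last hd]
    have h1 := mul_le_mul_of_nonneg_right hlast hQ
    have h3 : h * (φ (d - 1) * Q - V) ≤ h * reaction p (node x (d - 1)) := by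
      gcongr
      linarith [neg_le_reaction p (node x (d - 1))]
    have h2 := mul_le_mul_of_nonneg_left
      (show (φ (d - 1) - φ (d - 2) + h * φ (d - 1)) * Q - (2 * V + h * V) ≤
        -node x (d - 1) + node x (d - 2) + h * reaction p (node x (d - 1)) by
        nlinarith [hn (d - 2) (by omega)]) hpos.le
    nlinarith
  · rw [drift_interior h p x h0 (by omega)]
    have h1 := mul_le_mul_of_nonneg_right (hint k h0) hQ
    have h2 := mul_le_mul_of_nonneg_left
      (show (2 * φ k - φ (k + 1) - φ (k - 1)) * Q - 2 * (2 * V + h * V) ≤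
        node x (k + 1) - 2 * node x k + node x (k - 1) by
        nlinarith [hn (k + 1) (by omega), hn (k - 1) (by omega)])
      (show 0 ≤ 1 / h ^ 2 by positivity)
    have e3 : 1 / h ^ 2 * (2 * (2 * V + h * V)) = 2 / h ^ 2 * (2 * V + h * V) := by ring
    nlinarith

/-! ### Paths driven by a continuous function -/

/-- `x` solves `dx = b(x) dt + ε dw` on `[0, ∞)` for the deterministic continuous path `w`, in the
sense that `x - ε w` has right derivative `b(x)`. -/
structure IsDrivenPath {d : ℕ} (b : State d → State d) (ε : ℝ) (x w : ℝ → State d) : Prop where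
  continuous_left : Continuous x
  continuous_right : Continuous w
  hasDeriv : ∀ t : ℝ, 0 ≤ t → HasDerivWithinAt (fun r => x r - ε • w r) (b (x t)) (Ici t) t

namespace IsDrivenPath

variable {d : ℕ} {b : State d → State d} {ε : ℝ} {x w : ℝ → State d}

lemma continuous_coord_left (hx : IsDrivenPath b ε x w) (i : Fin d) :
    Continuous fun t => x t i :=
  (EuclideanSpace.proj (𝕜 := ℝ) i).continuous.comp hx.continuous_left

lemma continuous_coord_right (hx : IsDrivenPath b ε x w) (i : Fin d) :
    Continuous fun t => w t i :=
  (EuclideanSpace.proj (𝕜 := ℝ) i).continuous.comp hx.continuous_right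

/-- The coordinates of `x` minus the noise accumulated since time `s`. -/
lemma hasDerivWithinAt_coord (hx : IsDrivenPath b ε x w) (s : ℝ) {t : ℝ} (ht : 0 ≤ t)
    (i : Fin d) :
    HasDerivWithinAt (fun r => x r i - ε * (w r i - w s i)) (b (x t) i) (Ici t) t := by
  have h1 : HasDerivWithinAt (fun r => (x r - ε • w r) i) (b (x t) i) (Ici t) t :=
    (EuclideanSpace.proj (𝕜 := ℝ) i).hasFDerivAt.comp_hasDerivWithinAt t (hx.hasDeriv t ht)
  refine (h1.add_const (ε * w s i)).congr_of_eventuallyEq ?_ ?_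
  · exact Eventually.of_forall fun r => by simp; ring
  · simp; ring

end IsDrivenPath

section Window

variable {d : ℕ} {h p ε : ℝ} {x w : ℝ → State d}

/-- A family of barriers `ψ` is not crossed if at each touching point the drift exceeds the speed
of the barrier. -/
lemma IsDrivenPath.barrier (hx : IsDrivenPath (drift d h p) ε x w) {s η V : ℝ} (hs : 0 ≤ s)
    (hV : ∀ t ∈ Icc s (s + η), ∀ i, |ε * (w t i - w s i)| ≤ V)
    {ψ ψ' : Fin d → ℝ → ℝ} (hψ : ∀ i t, HasDerivAt (ψ i) (ψ' i t) t)
    (h0 : ∀ i, ψ i s ≤ x s i)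
    (hcross : ∀ t ∈ Ico s (s + η), (∀ j, ψ j t - V ≤ x t j) →
      ∀ i, x t i ≤ ψ i t + V → ψ' i t < drift d h p (x t) i) :
    ∀ t ∈ Icc s (s + η), ∀ i, ψ i t + ε * (w t i - w s i) ≤ x t i := by
  have key := nonneg_of_pos_deriv_at_zero (a := s) (b := s + η)
    (f := fun i r => x r i - ε * (w r i - w s i) - ψ i r)
    (f' := fun i r => drift d h p (x r) i - ψ' i r) ?_ ?_ ?_ ?_
  · intro t ht i
    linarith [key t ht i]
  · intro i
    have h1 := hx.continuous_coord_left i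
    have h2 := hx.continuous_coord_right i
    have h3 : Continuous (ψ i) :=
      continuous_iff_continuousAt.2 fun t => (hψ i t).continuousAt
    exact ((h1.sub ((h2.sub continuous_const).const_mul ε)).sub h3).continuousOn
  · intro i t ht
    exact (hx.hasDerivWithinAt_coord s (hs.trans ht.1) i).fun_sub (hψ i t).hasDerivWithinAt
  · intro i
    simpa using h0 i
  · intro t ht hnn i hi
    have hb := fun j => abs_le.1 (hV t (Ico_subset_Icc_self ht) j)
    refine sub_pos.2 (hcross t ht (fun j => ?_) i ?_)
    · linarith [hnn j, (hb j).1]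
    · linarith [(hb i).2]

/-- The loss of the lower bound of a driven path over a time interval is at most linear. -/
lemma IsDrivenPath.sub_mul_add_le (hd : 2 ≤ d) (hh : 0 < h) (hp : 1 < p)
    (hx : IsDrivenPath (drift d h p) ε x w) {s η V m : ℝ} (hs : 0 ≤ s)
    (hV : ∀ t ∈ Icc s (s + η), ∀ i, |ε * (w t i - w s i)| ≤ V) (h0 : ∀ i, m ≤ x s i) :
    ∀ t ∈ Icc s (s + η), ∀ i,
      m - (4 * V / h ^ 2 + 2 / h + 1) * (t - s) + ε * (w t i - w s i) ≤ x t i := by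
  refine hx.barrier hs hV (ψ := fun _ t => m - (4 * V / h ^ 2 + 2 / h + 1) * (t - s))
    (ψ' := fun _ _ => -(4 * V / h ^ 2 + 2 / h + 1)) ?_ (by simpa using h0) ?_
  · intro i t
    simpa only [mul_one] using (((hasDerivAt_id' t).sub_const s).const_mul
      (4 * V / h ^ 2 + 2 / h + 1)).const_sub m
  · intro t _ hlow i hup
    have := le_drift_of_const hd hh hp hlow i hup
    linarith

/-- The deficit of a driven path, measured in units of the supersolution `φ`, contracts by the
factor `exp (-κ η)` over a time interval of length `η`, up to the oscillation of the noise. -/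
lemma exists_contraction (hd : 2 ≤ d) (hh : 0 < h) :
    ∃ (φ : ℕ → ℝ) (κ C : ℝ), 0 < κ ∧ 0 < C ∧ (∀ k < d, 1 / 2 ≤ φ k ∧ φ k ≤ 1) ∧
      ∀ {p ε : ℝ} {x w : ℝ → State d}, IsDrivenPath (drift d h p) ε x w →
      ∀ {s η V D : ℝ}, 0 ≤ s → 0 ≤ η → 0 ≤ D →
        (∀ t ∈ Icc s (s + η), ∀ i, |ε * (w t i - w s i)| ≤ V) →
        (∀ i : Fin d, -(φ i * D) ≤ x s i) →
        ∀ i : Fin d, -(φ i * (Real.exp (-κ * η) * D + C * (V + 1))) ≤ x (s + η) i := by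
  obtain ⟨φ, κ, hκ, hφ, hfirst, hint, hlast⟩ := exists_supersolution hd hh
  set C₁ : ℝ := 4 / h ^ 2 + 2 / h with hC₁
  have hC₁0 : 0 < C₁ := by positivity
  refine ⟨φ, κ, 2 * C₁ / κ + 3, hκ, by positivity, hφ, ?_⟩
  intro p ε x w hx s η V D hs hη hD hV h0 i
  have hend : s + η ∈ Icc s (s + η) := ⟨by linarith, le_rfl⟩
  have hV0 : 0 ≤ V := (abs_nonneg _).trans (hV _ hend i)
  set E : ℝ := 2 * C₁ * V / κ + 1 with hE
  have hE0 : 0 < E := by positivity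
  -- `κ E / 2 = C₁ V + κ / 2` exceeds what the noise can take away from the drift.
  have hκE : κ * E = 2 * C₁ * V + κ := by rw [hE]; field_simp
  have key := hx.barrier hs hV
    (ψ := fun i t => -(φ i * (Real.exp (-κ * (t - s)) * D + E)))
    (ψ' := fun i t => φ i * (κ * (Real.exp (-κ * (t - s)) * D))) ?_ ?_ ?_ (s + η) hend i
  · have h1 := (abs_le.1 (hV _ hend i)).1
    simp only [add_sub_cancel_left] at key
    have h2 := hφ i i.2
    have h3 : E + 2 * V ≤ (2 * C₁ / κ + 3) * (V + 1) := by
      have : 0 ≤ 2 * C₁ / κ := by positivity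
      rw [hE, show 2 * C₁ * V / κ = 2 * C₁ / κ * V by ring]
      nlinarith
    have h4 := mul_le_mul_of_nonneg_left h3 (show 0 ≤ φ i by linarith)
    nlinarith
  · intro j t
    have := ((((hasDerivAt_id' t).sub_const s).const_mul (-κ)).exp.mul_const D).add_const E
    exact (this.const_mul (φ j)).fun_neg.congr_deriv (by ring)
  · intro j
    have h1 := h0 j
    have h2 := hφ j j.2
    simp only [sub_self, mul_zero, Real.exp_zero, one_mul]
    nlinarith
  · intro t _ hlow j hup
    set Q := Real.exp (-κ * (t - s)) * D with hQdef
    have hQ : 0 ≤ Q := by positivity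
    have h1 := le_drift_of_supersolution (p := p) hd hh hfirst hint hlast
      (show 0 ≤ Q + E by linarith) hlow j hup
    have h2 := hφ j j.2
    have h3 : φ j * (κ * Q) ≤ κ * Q := mul_le_of_le_one_left (by positivity) h2.2
    have h5 : 0 ≤ C₁ * V := by positivity
    nlinarith

/-- A driven path cannot start too high: the superlinear reaction makes its last coordinate blow
up before the end of the time interval. -/
lemma exists_blowup_level (hd : 2 ≤ d) (hh : 0 < h) (hp : 1 < p) {η : ℝ} (hη : 0 < η) (V : ℝ) :
    ∃ K : ℝ, ∀ {ε : ℝ} {x w : ℝ → State d}, IsDrivenPath (drift d h p) ε x w →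
      ∀ {s : ℝ}, 0 ≤ s → (∀ t ∈ Icc s (s + η), ∀ i, |ε * (w t i - w s i)| ≤ V) →
        ¬ ∀ i, K ≤ x s i := by
  have hp1 : 0 < p - 1 := by linarith
  obtain ⟨A, hA1, hA2, hA3⟩ : ∃ A : ℝ, 1 ≤ A ∧
      (∀ y, A ≤ y → 2 * (1 + h) / h ≤ y ^ (p - 1)) ∧ A ^ (-(p - 1)) < (p - 1) / h * η := by
    obtain ⟨A₁, h₁⟩ := eventually_atTop.1
      ((tendsto_rpow_atTop hp1).eventually_ge_atTop (2 * (1 + h) / h))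
    obtain ⟨A₂, h₂⟩ := eventually_atTop.1
      ((tendsto_rpow_neg_atTop hp1).eventually
        (gt_mem_nhds (show 0 < (p - 1) / h * η by positivity)))
    exact ⟨max 1 (max A₁ A₂), le_max_left _ _,
      fun y hy => h₁ y (((le_max_left _ _).trans (le_max_right _ _)).trans hy),
      h₂ _ ((le_max_right _ _).trans (le_max_right _ _))⟩
  set c : ℝ := 4 * V / h ^ 2 + 2 / h + 1 with hc
  refine ⟨A + c * η + 2 * V, ?_⟩
  intro ε x w hx s hs hV hK
  have hlow := hx.sub_mul_add_le hd hh hp hs hV hK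
  let l : Fin d := ⟨d - 1, by omega⟩
  have hV0 : 0 ≤ V := (abs_nonneg _).trans (hV s ⟨le_rfl, by linarith⟩ l)
  have hc0 : 0 ≤ c := by positivity
  have hct : ∀ t ∈ Icc s (s + η), c * (t - s) ≤ c * η := fun t ht =>
    mul_le_mul_of_nonneg_left (by linarith [ht.2]) hc0
  -- Without the noise, and shifted by `V` to lie below it, the last coordinate is differentiable
  -- from the right.
  set y : ℝ → ℝ := fun t => x t l - ε * (w t l - w s l) - V with hy
  have hyA : ∀ t ∈ Icc s (s + η), A ≤ y t := fun t ht => by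
    have := hlow t ht l
    have := hct t ht
    simp only [hy]
    linarith
  have hyx : ∀ t ∈ Icc s (s + η), y t ≤ x t l := fun t ht => by
    have := (abs_le.1 (hV t ht l)).1
    simp only [hy]
    linarith
  have hdrift : ∀ t ∈ Icc s (s + η), 1 / h * y t ^ p ≤ drift d h p (x t) l := by
    intro t ht
    have hx1 : 0 ≤ node (x t) (d - 2) := by
      rw [node_of_lt _ (by omega)]
      have := hlow t ht ⟨d - 2, by omega⟩
      have := hct t ht
      have := (abs_le.1 (hV t ht ⟨d - 2, by omega⟩)).1
      linarith
    have hx2 : x t l = node (x t) (d - 1) := (node_of_lt _ (by omega)).symm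
    have hA := hyA t ht
    have hyx := hyx t ht
    rw [hx2] at hyx
    rw [drift_last hd]
    set X := node (x t) (d - 1)
    have hX : A ≤ X := hA.trans hyx
    have hX0 : 0 < X := by linarith
    have hpow : X ^ p = X ^ (p - 1) * X := by
      rw [← Real.rpow_add_one hX0.ne', sub_add_cancel]
    have hmono : y t ^ p ≤ X ^ p := Real.rpow_le_rpow (by linarith) hyx (by linarith)
    have h1 : 2 * (1 + h) * X ≤ h * X ^ p := by
      have := (div_le_iff₀ hh).1 (hA2 X hX)
      rw [hpow]
      nlinarith
    have h2 : reaction p X = X ^ p - X := by rw [reaction, max_eq_left hX0.le]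
    rw [h2]
    have h3 : h / 2 * y t ^ p ≤ -X + node (x t) (d - 2) + h * (X ^ p - X) := by nlinarith
    have h4 : 1 / h * y t ^ p = 2 / h ^ 2 * (h / 2 * y t ^ p) := by field_simp
    rw [h4]
    gcongr
  have hend : s + η ∈ Icc s (s + η) := ⟨by linarith, le_rfl⟩
  -- Compare `y ^ (1 - p)` with the affine function of slope `-(p - 1) / h`.
  have hcmp := image_le_of_deriv_right_le_deriv_boundary (a := s) (b := s + η)
    (f := fun t => y t ^ (-(p - 1)))
    (f' := fun t => drift d h p (x t) l * (-(p - 1)) * y t ^ (-(p - 1) - 1))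
    (B := fun t => A ^ (-(p - 1)) - (p - 1) / h * (t - s))
    (B' := fun _ => -((p - 1) / h)) ?_ ?_ ?_ ?_ ?_ ?_ hend
  · simp only [add_sub_cancel_left] at hcmp
    have : 0 < y (s + η) ^ (-(p - 1)) := Real.rpow_pos_of_pos (by linarith [hyA _ hend]) _
    linarith
  · have hyc : Continuous y := by
      have h1 := hx.continuous_coord_left l
      have h2 := hx.continuous_coord_right l
      exact (h1.sub ((h2.sub continuous_const).const_mul ε)).sub continuous_const
    exact hyc.continuousOn.rpow_const fun t ht => Or.inl (by linarith [hyA t ht])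
  · intro t ht
    have := ((hx.hasDerivWithinAt_coord s (hs.trans ht.1) l).sub_const V).rpow_const
      (p := -(p - 1)) (Or.inl (show y t ≠ 0 by linarith [hyA t (Ico_subset_Icc_self ht)]))
    exact this
  · simp only [sub_self, mul_zero, sub_zero]
    exact Real.rpow_le_rpow_of_nonpos (by linarith) (hyA s ⟨le_rfl, by linarith⟩) (by linarith)
  · fun_prop
  · intro t _
    simpa only [mul_one] using ((((hasDerivAt_id' t).sub_const s).const_mul
      ((p - 1) / h)).const_sub (A ^ (-(p - 1)))).hasDerivWithinAt
  · intro t ht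
    have ht' := Ico_subset_Icc_self ht
    have hy0 : 0 < y t := by linarith [hyA t ht']
    have h1 := hdrift t ht'
    have h2 : y t ^ p * y t ^ (-(p - 1) - 1) = 1 := by
      rw [← Real.rpow_add hy0]
      simp
    have h3 : 0 < y t ^ (-(p - 1) - 1) := Real.rpow_pos_of_pos hy0 _
    have h4 := mul_le_mul_of_nonneg_right h1 (mul_pos hp1 h3).le
    have h5 : 1 / h * y t ^ p * ((p - 1) * y t ^ (-(p - 1) - 1)) = (p - 1) / h := by
      calc _ = (p - 1) / h * (y t ^ p * y t ^ (-(p - 1) - 1)) := by ring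
        _ = _ := by rw [h2, mul_one]
    simp only
    linarith

end Window

/-! ### Oscillation of Brownian motion on a window -/

/-- A bound for the oscillation of `f` on `[s, s + σ²]` obtained by dyadic chaining. The level-`n`
increment `Δ` is estimated by `|Δ| ≤ a + Δ⁴ / a³` with `a = σ (9/10)^n`, and all increments of one
level are added up; `9/10` is close enough to `1` for the expectation to be finite when `f` is a
Brownian path. -/
noncomputable def chainingBound (σ s : ℝ≥0) (f : ℝ≥0 → ℝ) : ℝ≥0∞ :=
  ∑' n : ℕ, (ENNReal.ofReal (σ * (9 / 10) ^ n) + ∑ k ∈ Finset.range (2 ^ n),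
    ENNReal.ofReal ((f (s + (k + 1) / 2 ^ n * σ ^ 2) - f (s + k / 2 ^ n * σ ^ 2)) ^ 4 /
      (σ * (9 / 10) ^ n) ^ 3))

lemma abs_le_add_pow_four_div (x : ℝ) {a : ℝ} (ha : 0 < a) : |x| ≤ a + x ^ 4 / a ^ 3 := by
  have h4 : x ^ 4 = |x| ^ 4 := (Even.pow_abs (by decide) x).symm
  rw [h4]
  have hx := abs_nonneg x
  rcases le_total |x| a with h | h
  · have : 0 ≤ |x| ^ 4 / a ^ 3 := by positivity
    linarith
  · have : |x| ≤ |x| ^ 4 / a ^ 3 := by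
      rw [le_div_iff₀ (by positivity)]
      have := pow_le_pow_left₀ ha.le h 3
      nlinarith
    linarith

lemma ofReal_abs_sub_le_chainingBound {σ s : ℝ≥0} (hσ : 0 < σ) {f : ℝ≥0 → ℝ} (hf : Continuous f)
    {t : ℝ≥0} (ht : t ≤ σ ^ 2) :
    ENNReal.ofReal |f (s + t) - f s| ≤ chainingBound σ s f := by
  have hσ' : (0 : ℝ) < σ := hσ
  have key := edist_le_tsum_of_dyadic (g := fun y => f (s + y * σ ^ 2)) (by fun_prop)
    (fun n : ℕ => ENNReal.ofReal (σ * (9 / 10) ^ n) + ∑ k ∈ Finset.range (2 ^ n),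
      ENNReal.ofReal ((f (s + (k + 1) / 2 ^ n * σ ^ 2) - f (s + k / 2 ^ n * σ ^ 2)) ^ 4 /
        (σ * (9 / 10) ^ n) ^ 3)) ?_ (y := t / σ ^ 2) (div_le_one_of_le₀ ht zero_le)
  · have e : t / σ ^ 2 * σ ^ 2 = t := div_mul_cancel₀ _ (by positivity)
    simp only [zero_mul, add_zero, e] at key
    rwa [edist_comm, edist_dist, Real.dist_eq] at key
  · intro n k hk
    rw [edist_comm, edist_dist, Real.dist_eq]
    refine (ENNReal.ofReal_le_ofReal (abs_le_add_pow_four_div _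
      (show 0 < (σ : ℝ) * (9 / 10) ^ n by positivity))).trans ?_
    refine ENNReal.ofReal_add_le.trans (add_le_add le_rfl ?_)
    exact Finset.single_le_sum (f := fun k : ℕ =>
      ENNReal.ofReal ((f (s + (k + 1) / 2 ^ n * σ ^ 2) - f (s + k / 2 ^ n * σ ^ 2)) ^ 4 /
        (σ * (9 / 10) ^ n) ^ 3)) (fun _ _ => zero_le) (Finset.mem_range.2 hk)

lemma measurable_chainingBound {Ω : Type*} {mΩ : MeasurableSpace Ω} {Y : ℝ≥0 → Ω → ℝ} {σ s : ℝ≥0}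
    (hY : ∀ t ≤ s + σ ^ 2, Measurable (Y t)) :
    Measurable fun ω => chainingBound σ s (fun t => Y t ω) := by
  unfold chainingBound
  refine Measurable.tsum fun n =>
    Measurable.const_add (Finset.measurable_fun_sum _ fun k hk => ?_) _
  have hk' : ((k : ℝ≥0) + 1) / 2 ^ n ≤ 1 := by
    rw [div_le_one (by positivity)]
    exact_mod_cast Finset.mem_range.1 hk
  have hk'' : (k : ℝ≥0) / 2 ^ n ≤ 1 := le_trans (by gcongr; exact le_self_add) hk'
  have h1 := hY _ (add_le_add_right (mul_le_of_le_one_left (zero_le (a := σ ^ 2)) hk') s)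
  have h2 := hY _ (add_le_add_right (mul_le_of_le_one_left (zero_le (a := σ ^ 2)) hk'') s)
  exact (((h1.sub h2).pow_const 4).div_const _).ennreal_ofReal

/-- The fourth moment of the standard Gaussian law. -/
noncomputable def gaussianFourthMoment : ℝ≥0∞ := ∫⁻ x, ENNReal.ofReal (x ^ 4) ∂gaussianReal 0 1

lemma gaussianFourthMoment_ne_top : gaussianFourthMoment ≠ ∞ := by
  have h := (memLp_id_gaussianReal (μ := 0) (v := 1) 4).integrable_norm_pow (p := 4) (by norm_num)
  have h2 : Integrable (fun x : ℝ => x ^ 4) (gaussianReal 0 1) := by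
    refine h.congr (Eventually.of_forall fun x => ?_)
    simp [Even.pow_abs (show Even 4 by decide) x]
  exact h2.lintegral_lt_top.ne

lemma lintegral_pow_four_gaussianReal (v : ℝ≥0) {a : ℝ} (ha : 0 ≤ a) :
    ∫⁻ x, ENNReal.ofReal (x ^ 4 / a) ∂gaussianReal 0 v =
      ENNReal.ofReal ((v : ℝ) ^ 2 / a) * gaussianFourthMoment := by
  have hmap : gaussianReal 0 v = (gaussianReal 0 1).map (fun x => √(v : ℝ) * x) := by
    rw [gaussianReal_map_const_mul]
    congr 1
    · simp
    · ext
      simp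
  have hsq : √(v : ℝ) ^ 4 = (v : ℝ) ^ 2 := by
    rw [show √(v : ℝ) ^ 4 = (√(v : ℝ) ^ 2) ^ 2 by ring, Real.sq_sqrt (NNReal.coe_nonneg v)]
  rw [hmap, lintegral_map (by fun_prop) (by fun_prop), gaussianFourthMoment,
    ← lintegral_const_mul _ (by fun_prop)]
  refine lintegral_congr fun x => ?_
  rw [← ENNReal.ofReal_mul (by positivity), mul_pow, hsq]
  congr 1
  ring

/-- The sum over all dyadic levels of the expected chaining terms on a window of length one. At
level `n` there are `2 ^ n` increments of variance `2 ^ (-n)`, which gives the ratio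
`500 / 729 = 2 * (1 / 2) ^ 2 / (9 / 10) ^ 3`. -/
noncomputable def chainingConst : ℝ≥0∞ :=
  ∑' n : ℕ, (ENNReal.ofReal ((9 / 10) ^ n) +
    ENNReal.ofReal ((500 / 729) ^ n) * gaussianFourthMoment)

lemma chainingConst_ne_top : chainingConst ≠ ∞ := by
  have hgeom : ∀ r : ℝ, 0 ≤ r → r < 1 → ∑' n : ℕ, ENNReal.ofReal (r ^ n) ≠ ∞ := by
    intro r h0 h1
    rw [← ENNReal.ofReal_tsum_of_nonneg (fun n => pow_nonneg h0 n)
      (summable_geometric_of_lt_one h0 h1)]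
    exact ENNReal.ofReal_ne_top
  rw [chainingConst, ENNReal.tsum_add, ENNReal.tsum_mul_right]
  exact ENNReal.add_ne_top.2 ⟨hgeom _ (by norm_num) (by norm_num),
    ENNReal.mul_ne_top (hgeom _ (by norm_num) (by norm_num)) gaussianFourthMoment_ne_top⟩

section Brownian

variable {Ω : Type*} {m : MeasurableSpace Ω} {d : ℕ} {F : Filtration ℝ≥0 m} {P : Measure Ω}
  {W : ℝ≥0 → Ω → State d}

lemma IsStandardBrownian.measurable_coord (hW : IsStandardBrownian F P W) {s t : ℝ≥0} (hst : s ≤ t)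
    (i : Fin d) : Measurable[F t] (fun ω => W s ω i) :=
  (EuclideanSpace.proj (𝕜 := ℝ) i).continuous.measurable.comp
    ((hW.adapted s).mono (F.mono hst) le_rfl)

lemma IsStandardBrownian.hasLaw_increment (hW : IsStandardBrownian F P W) (i : Fin d)
    (s v : ℝ≥0) : HasLaw (fun ω => W (s + v) ω i - W s ω i) (gaussianReal 0 v) P := by
  have h := (hW.coord_isBrownian i).toIsPreBrownianReal.hasLaw_sub (s + v) s
  have e : nndist (s + v).1 s.1 = v := by
    ext
    change dist ((s : ℝ) + v) s = v
    simp
  rw [e] at h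
  exact h

/-- The fourth moment of an increment after time `s`, conditionally on an event of the past. -/
lemma IsStandardBrownian.setLIntegral_increment_pow_four (hW : IsStandardBrownian F P W)
    (i : Fin d) {r s v : ℝ≥0} (hrs : r ≤ s) {A : Set Ω} (hA : MeasurableSet[F r] A) {a : ℝ}
    (ha : 0 ≤ a) :
    ∫⁻ ω in A, ENNReal.ofReal ((W (s + v) ω i - W s ω i) ^ 4 / a) ∂P =
      ENNReal.ofReal ((v : ℝ) ^ 2 / a) * gaussianFourthMoment * P A := by
  have hAm : MeasurableSet A := F.le r A hA
  have hWm : ∀ t, Measurable (W t) := fun t => (hW.adapted t).mono (F.le t) le_rfl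
  have hlaw := hW.hasLaw_increment i s v
  have hcomap : Measurable[MeasurableSpace.comap (fun ω => W (s + v) ω - W s ω) inferInstance]
      (fun ω => ENNReal.ofReal ((W (s + v) ω i - W s ω i) ^ 4 / a)) := by
    have h1 : Measurable fun y : State d => ENNReal.ofReal ((y i) ^ 4 / a) := by fun_prop
    have e : (fun ω => ENNReal.ofReal ((W (s + v) ω i - W s ω i) ^ 4 / a)) =
        (fun y : State d => ENNReal.ofReal ((y i) ^ 4 / a)) ∘ fun ω => W (s + v) ω - W s ω := by
      funext ω
      simp
    rw [e]
    exact h1.comp (comap_measurable _)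
  have hind : IndepSets
      {B | MeasurableSet[MeasurableSpace.comap (fun ω => W (s + v) ω - W s ω) inferInstance] B}
      {A} P :=
    indepSets_of_indepSets_of_le_right (hW.increment_indep s (s + v) le_self_add)
      (singleton_subset_iff.2 (F.mono hrs A hA))
  have hprod := lintegral_mul_indicator_eq_lintegral_mul_lintegral_indicator
    (((hWm (s + v)).sub (hWm s)).comap_le) 1 hAm hind hcomap
  rw [lintegral_indicator_const hAm, one_mul] at hprod
  rw [← lintegral_pow_four_gaussianReal v ha, ← lintegral_indicator hAm,
    ← hlaw.map_eq, lintegral_map' (by fun_prop) hlaw.aemeasurable, ← hprod]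
  refine lintegral_congr fun ω => ?_
  by_cases h : ω ∈ A <;> simp [h]

/-- The sum over the coordinates of the chaining bounds on the window `[s, s + σ²]`. -/
noncomputable def windowOscillation (W : ℝ≥0 → Ω → State d) (σ s : ℝ≥0) (ω : Ω) : ℝ≥0∞ :=
  ∑ i, chainingBound σ s (fun t => W t ω i)

lemma IsStandardBrownian.measurable_windowOscillation (hW : IsStandardBrownian F P W)
    (σ s : ℝ≥0) : Measurable[F (s + σ ^ 2)] (windowOscillation W σ s) := by
  unfold windowOscillation
  exact Finset.measurable_fun_sum _ fun i _ =>
    measurable_chainingBound (mΩ := F (s + σ ^ 2)) fun t ht => hW.measurable_coord ht i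

/-- Conditionally on the past, the expected oscillation on a window of length `σ²` is at most a
constant times `σ`. -/
lemma IsStandardBrownian.setLIntegral_windowOscillation_le (hW : IsStandardBrownian F P W)
    {σ : ℝ≥0} (hσ : 0 < σ) (s : ℝ≥0) {A : Set Ω} (hA : MeasurableSet[F s] A) :
    ∫⁻ ω in A, windowOscillation W σ s ω ∂P ≤ σ * (d * chainingConst) * P A := by
  have hσ' : (0 : ℝ) < σ := hσ
  have hm : ∀ t i, Measurable fun ω => W t ω i := fun t i =>
    (hW.measurable_coord (le_refl t) i).mono (F.le t) le_rfl
  have hmt : ∀ i (t r : ℝ≥0) (a : ℝ), Measurable fun ω =>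
      ENNReal.ofReal ((W t ω i - W r ω i) ^ 4 / a) := fun i t r a =>
    ((((hm t i).sub (hm r i)).pow_const 4).div_const a).ennreal_ofReal
  have hlevel : ∀ i (n : ℕ), Measurable fun ω => ∑ k ∈ Finset.range (2 ^ n), ENNReal.ofReal
      ((W (s + (k + 1) / 2 ^ n * σ ^ 2) ω i - W (s + k / 2 ^ n * σ ^ 2) ω i) ^ 4 /
        (σ * (9 / 10) ^ n) ^ 3) := fun i n =>
    Finset.measurable_fun_sum _ fun k _ => hmt i _ _ _
  have hcoord : ∀ i, ∫⁻ ω in A, chainingBound σ s (fun t => W t ω i) ∂P =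
      σ * chainingConst * P A := by
    intro i
    have hterm : ∀ n k : ℕ, ∫⁻ ω in A, ENNReal.ofReal
        ((W (s + (k + 1) / 2 ^ n * σ ^ 2) ω i - W (s + k / 2 ^ n * σ ^ 2) ω i) ^ 4 /
          (σ * (9 / 10) ^ n) ^ 3) ∂P =
        ENNReal.ofReal (σ * (250 / 729) ^ n) * gaussianFourthMoment * P A := by
      intro n k
      have e : s + ((k : ℝ≥0) + 1) / 2 ^ n * σ ^ 2 =
          (s + (k : ℝ≥0) / 2 ^ n * σ ^ 2) + 1 / 2 ^ n * σ ^ 2 := by ring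
      rw [e, hW.setLIntegral_increment_pow_four i le_self_add hA (by positivity)]
      congr 3
      push_cast
      have e2 : (250 / 729 : ℝ) ^ n = (1 / 2 ^ n) ^ 2 / ((9 / 10) ^ n) ^ 3 := by
        rw [show (250 / 729 : ℝ) = (1 / 2) ^ 2 / (9 / 10) ^ 3 by norm_num, div_pow, ← pow_mul,
          ← pow_mul, ← one_div_pow, ← pow_mul, ← pow_mul, mul_comm n 2, mul_comm n 3]
      rw [e2]
      field_simp
    unfold chainingBound
    rw [lintegral_tsum (fun n => ((hlevel i n).const_add _).aemeasurable), chainingConst,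
      ← ENNReal.tsum_mul_left, ← ENNReal.tsum_mul_right]
    congr 1
    ext n
    rw [lintegral_add_left measurable_const, lintegral_const, Measure.restrict_apply_univ,
      lintegral_finsetSum _ (fun k _ => hmt i _ _ _)]
    simp only [hterm, Finset.sum_const, Finset.card_range, nsmul_eq_mul]
    have h1 : ENNReal.ofReal (σ * (9 / 10) ^ n) = σ * ENNReal.ofReal ((9 / 10) ^ n) := by
      rw [ENNReal.ofReal_mul hσ'.le, ENNReal.ofReal_coe_nnreal]
    have h2 : ((2 ^ n : ℕ) : ℝ≥0∞) * ENNReal.ofReal (σ * (250 / 729) ^ n) =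
        σ * ENNReal.ofReal ((500 / 729) ^ n) := by
      rw [ENNReal.ofReal_mul hσ'.le, ENNReal.ofReal_coe_nnreal, ← ENNReal.ofReal_natCast,
        mul_left_comm, ← ENNReal.ofReal_mul (by positivity)]
      congr 2
      push_cast
      rw [← mul_pow]
      norm_num
    rw [h1, ← mul_assoc, ← mul_assoc, h2]
    ring
  unfold windowOscillation
  rw [lintegral_finsetSum]
  · simp only [hcoord, Finset.sum_const, Finset.card_univ, Fintype.card_fin, nsmul_eq_mul]
    exact le_of_eq (by ring)
  · intro i _
    exact Measurable.tsum fun n => (hlevel i n).const_add _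

/-- By scaling, the conditional probability given the past that all coordinates of `W` gain at least
`σ` over a window of length `σ²` does not depend on `σ`. -/
lemma IsStandardBrownian.measure_inter_jump (hW : IsStandardBrownian F P W)
    {σ : ℝ≥0} (hσ : 0 < σ) (s : ℝ≥0) {A : Set Ω} (hA : MeasurableSet[F s] A) :
    P (A ∩ {ω | ∀ i, (σ : ℝ) ≤ W (s + σ ^ 2) ω i - W s ω i}) =
      P A * gaussianReal 0 1 (Ici 1) ^ d := by
  have hσ' : (0 : ℝ) < σ := hσ
  have hset : {ω | ∀ i, (σ : ℝ) ≤ W (s + σ ^ 2) ω i - W s ω i} =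
      ⋂ i, {ω | (σ : ℝ) ≤ W (s + σ ^ 2) ω i - W s ω i} := by
    ext
    simp
  have hind := (Indep_iff _ _ P).1 (hW.increment_indep s (s + σ ^ 2) le_self_add)
    {ω | ∀ i, (σ : ℝ) ≤ W (s + σ ^ 2) ω i - W s ω i} A ?_ hA
  · rw [inter_comm, hind, mul_comm]
    congr 1
    rw [hset, hW.coord_indep.meas_iInter (s := fun i =>
      {ω | (σ : ℝ) ≤ W (s + σ ^ 2) ω i - W s ω i})]
    · rw [Finset.prod_congr rfl (g := fun _ => gaussianReal 0 1 (Ici 1))]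
      · simp
      intro i _
      have hlaw := hW.hasLaw_increment i s (σ ^ 2)
      have e : {ω | (σ : ℝ) ≤ W (s + σ ^ 2) ω i - W s ω i} =
          (fun ω => W (s + σ ^ 2) ω i - W s ω i) ⁻¹' Ici (σ : ℝ) := rfl
      have hmap : gaussianReal 0 (σ ^ 2) = (gaussianReal 0 1).map (fun x => (σ : ℝ) * x) := by
        rw [gaussianReal_map_const_mul]
        congr 1
        · simp
        · ext
          simp
      rw [e, ← Measure.map_apply_of_aemeasurable hlaw.aemeasurable measurableSet_Ici,
        hlaw.map_eq, hmap, Measure.map_apply (by fun_prop) measurableSet_Ici]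
      congr 1
      ext x
      simp [le_mul_iff_one_le_right hσ']
    · intro i
      refine ⟨{f : ℝ≥0 → ℝ | (σ : ℝ) ≤ f (s + σ ^ 2) - f s}, ?_, rfl⟩
      exact measurableSet_le measurable_const
        ((measurable_pi_apply (s + σ ^ 2)).fun_sub (measurable_pi_apply s))
  · refine ⟨{y : State d | ∀ i, (σ : ℝ) ≤ y i}, ?_, rfl⟩
    have : {y : State d | ∀ i, (σ : ℝ) ≤ y i} = ⋂ i, {y : State d | (σ : ℝ) ≤ y i} := by
      ext
      simp
    rw [this]
    exact MeasurableSet.iInter fun i => measurableSet_le measurable_const (by fun_prop)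

/-- The event that on the window `[s, s + σ²]` the oscillation is at most `lam * σ` while every
coordinate gains at least `σ`. -/
def goodWindow (W : ℝ≥0 → Ω → State d) (lam σ s : ℝ≥0) : Set Ω :=
  {ω | (∀ i, (σ : ℝ) ≤ W (s + σ ^ 2) ω i - W s ω i) ∧
    windowOscillation W σ s ω ≤ lam * σ}

lemma IsStandardBrownian.measurableSet_jump (hW : IsStandardBrownian F P W) (σ s : ℝ≥0) :
    MeasurableSet[F (s + σ ^ 2)] {ω | ∀ i, (σ : ℝ) ≤ W (s + σ ^ 2) ω i - W s ω i} := by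
  have : {ω | ∀ i, (σ : ℝ) ≤ W (s + σ ^ 2) ω i - W s ω i} =
      ⋂ i, {ω | (σ : ℝ) ≤ W (s + σ ^ 2) ω i - W s ω i} := by
    ext
    simp
  rw [this]
  exact MeasurableSet.iInter fun i => measurableSet_le measurable_const
    ((hW.measurable_coord le_rfl i).sub (hW.measurable_coord le_self_add i))

lemma IsStandardBrownian.measurableSet_goodWindow (hW : IsStandardBrownian F P W)
    (lam σ s : ℝ≥0) : MeasurableSet[F (s + σ ^ 2)] (goodWindow W lam σ s) :=
  (hW.measurableSet_jump σ s).inter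
    (measurableSet_le (hW.measurable_windowOscillation σ s) measurable_const)

/-- For a suitable `lam`, windows of all lengths are good with a probability bounded below,
conditionally on the past: by scaling, both the probability of the gain and the expectation of the
oscillation divided by `σ` do not depend on `σ`. -/
lemma IsStandardBrownian.exists_le_measure_goodWindow [IsProbabilityMeasure P]
    (hW : IsStandardBrownian F P W) :
    ∃ (lam : ℝ≥0) (q : ℝ≥0∞), 0 < q ∧ ∀ σ : ℝ≥0, 0 < σ → ∀ (s : ℝ≥0) (A : Set Ω),
      MeasurableSet[F s] A → q * P A ≤ P (A ∩ goodWindow W lam σ s) := by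
  set Q : ℝ≥0∞ := gaussianReal 0 1 (Ici 1) ^ d with hQ
  have hQ0 : Q ≠ 0 := by
    refine pow_ne_zero _ fun h0 => ?_
    have := gaussianReal_absolutelyContinuous' 0 (v := 1) one_ne_zero h0
    simp at this
  have hQt : Q ≠ ∞ := ENNReal.pow_ne_top (measure_ne_top _ _)
  have hct : (d : ℝ≥0∞) * chainingConst ≠ ∞ :=
    ENNReal.mul_ne_top (ENNReal.natCast_ne_top d) chainingConst_ne_top
  -- Markov's inequality bounds the probability of a larger oscillation by `Q / 2`.
  obtain ⟨lam, hlam0, hlam⟩ : ∃ lam : ℝ≥0, 0 < lam ∧ d * chainingConst ≤ Q / 2 * lam := by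
    have hQ2 : Q / 2 ≠ 0 := by simp [hQ0]
    have ht : (d : ℝ≥0∞) * chainingConst / (Q / 2) ≠ ∞ := ENNReal.div_ne_top hct hQ2
    refine ⟨(d * chainingConst / (Q / 2)).toNNReal + 1, by positivity, ?_⟩
    rw [ENNReal.coe_add, ENNReal.coe_toNNReal ht, mul_add, ENNReal.mul_div_cancel hQ2
      (ENNReal.div_ne_top hQt (by norm_num))]
    exact le_self_add
  refine ⟨lam, Q / 2, ENNReal.half_pos hQ0, fun σ hσ s A hA => ?_⟩
  have hosc : Measurable (windowOscillation W σ s) :=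
    (hW.measurable_windowOscillation σ s).mono (F.le _) le_rfl
  have hls : (lam : ℝ≥0∞) * σ ≠ 0 := by
    simp [hlam0.ne', hσ.ne']
  have hlst : (lam : ℝ≥0∞) * σ ≠ ∞ := by finiteness
  have hmarkov : P (A ∩ {ω | lam * σ < windowOscillation W σ s ω}) ≤ Q / 2 * P A := by
    have h1 := mul_meas_ge_le_lintegral (μ := P.restrict A) hosc (lam * σ)
    have h2 := h1.trans (hW.setLIntegral_windowOscillation_le hσ s hA)
    have h3 : (lam : ℝ≥0∞) * σ * P (A ∩ {ω | lam * σ < windowOscillation W σ s ω}) ≤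
        lam * σ * (Q / 2 * P A) := by
      calc _ ≤ (lam : ℝ≥0∞) * σ * (P.restrict A) {ω | lam * σ ≤ windowOscillation W σ s ω} := by
            refine mul_le_mul_right ?_ _
            rw [Measure.restrict_apply (measurableSet_le measurable_const hosc), inter_comm]
            refine measure_mono (inter_subset_inter_left _ fun ω hω => ?_)
            rw [mem_ofPred_eq] at hω ⊢
            exact hω.le
        _ ≤ σ * (d * chainingConst) * P A := h2
        _ ≤ σ * (Q / 2 * lam) * P A := by gcongr
        _ = _ := by ring
    exact (ENNReal.mul_le_mul_iff_right hls hlst).1 h3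
  have hsub : A ∩ {ω | ∀ i, (σ : ℝ) ≤ W (s + σ ^ 2) ω i - W s ω i} ⊆
      (A ∩ goodWindow W lam σ s) ∪ (A ∩ {ω | lam * σ < windowOscillation W σ s ω}) := by
    rintro ω ⟨hωA, hω⟩
    rcases le_or_gt (windowOscillation W σ s ω) (lam * σ) with h | h
    · exact Or.inl ⟨hωA, hω, h⟩
    · exact Or.inr ⟨hωA, h⟩
  have htot : P A * Q ≤ P (A ∩ goodWindow W lam σ s) + Q / 2 * P A := by
    rw [hQ, ← hW.measure_inter_jump hσ s hA]
    exact (measure_mono hsub).trans ((measure_union_le _ _).trans (by gcongr))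
  have hsplit : P A * Q = Q / 2 * P A + Q / 2 * P A := by
    rw [← add_mul, ENNReal.add_halves, mul_comm]
  rw [hsplit] at htot
  exact (ENNReal.add_le_add_iff_right
    (ENNReal.mul_ne_top (ENNReal.div_ne_top hQt (by norm_num)) (measure_ne_top _ _))).1 htot

end Brownian

/-! ### Repeated trials with tight initial data -/

section Trials

variable {Ω : Type*} {m : MeasurableSpace Ω} {P : Measure Ω} {ℱ : ℕ → MeasurableSpace Ω}
  {G : ℕ → Set Ω} {q : ℝ≥0∞}

lemma pow_mul_le_measure_inter (hmono : Monotone ℱ) (hG : ∀ n, MeasurableSet[ℱ (n + 1)] (G n))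
    (hq : ∀ n A, MeasurableSet[ℱ n] A → q * P A ≤ P (A ∩ G n)) (n : ℕ) {A : Set Ω}
    (hA : MeasurableSet[ℱ n] A) (L : ℕ) :
    MeasurableSet[ℱ (n + L)] (A ∩ {ω | ∀ j < L, ω ∈ G (n + j)}) ∧
      q ^ L * P A ≤ P (A ∩ {ω | ∀ j < L, ω ∈ G (n + j)}) := by
  induction L with
  | zero => simpa using hA
  | succ L ih =>
    have e : A ∩ {ω | ∀ j < L + 1, ω ∈ G (n + j)} =
        (A ∩ {ω | ∀ j < L, ω ∈ G (n + j)}) ∩ G (n + L) := by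
      ext ω
      simp only [mem_inter_iff, mem_ofPred_eq, Nat.forall_lt_succ_right, and_assoc]
    rw [e]
    refine ⟨(hmono (Nat.le_succ _) _ ih.1).inter (hG _), le_trans ?_ (hq _ _ ih.1)⟩
    rw [pow_succ', mul_assoc]
    gcongr
    exact ih.2

/-- Suppose that the sequence `D` is bounded in expectation, and that each trial `G n` succeeds with
probability at least `q > 0` conditionally on its past. If for every level `R` a run of consecutive
successes starting at a time `n` with `D n ≤ R` forces the event `E`, then `E` is almost sure.
Blocks of consecutive trials are considered: the probability that no block so far has been
successful decreases at each block by a fixed multiple of the probability that moreover `D ≤ R` at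
its start, which by Markov's inequality differs little from the probability itself. -/
theorem ae_mem_of_trials [IsProbabilityMeasure P] (hmono : Monotone ℱ) (hle : ∀ n, ℱ n ≤ m)
    (hG : ∀ n, MeasurableSet[ℱ (n + 1)] (G n)) (hq0 : q ≠ 0)
    (hq : ∀ n A, MeasurableSet[ℱ n] A → q * P A ≤ P (A ∩ G n))
    {D : ℕ → Ω → ℝ≥0∞} (hD : ∀ n, Measurable[ℱ n] (D n)) {M : ℝ≥0∞} (hM : M ≠ ∞)
    (hDM : ∀ n, ∫⁻ ω, D n ω ∂P ≤ M) {E : Set Ω}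
    (hE : ∀ R : ℝ≥0, ∃ L : ℕ, ∀ᵐ ω ∂P, ∀ n, D n ω ≤ R → (∀ j < L, ω ∈ G (n + j)) → ω ∈ E) :
    ∀ᵐ ω ∂P, ω ∈ E := by
  have hbound : ∀ R : ℝ≥0, 0 < R → P Eᶜ ≤ M / R := by
    intro R hR
    obtain ⟨L, hL⟩ := hE R
    let B : ℕ → Set Ω := fun k => {ω | D (k * L) ω ≤ R}
    let S : ℕ → Set Ω := fun k => {ω | ∀ i < k, ω ∈ B i → ¬ ∀ j < L, ω ∈ G (i * L + j)}
    have hB : ∀ k, MeasurableSet[ℱ (k * L)] (B k) := fun k =>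
      measurableSet_le (hD _) measurable_const
    have hstep : ∀ k, MeasurableSet[ℱ (k * L)] (S k) →
        MeasurableSet[ℱ ((k + 1) * L)] (S (k + 1)) ∧
          P (S (k + 1)) + q ^ L * P (S k ∩ B k) ≤ P (S k) := by
      intro k hS
      obtain ⟨h1, h2⟩ := pow_mul_le_measure_inter hmono hG hq (k * L) (hS.inter (hB k)) L
      rw [show k * L + L = (k + 1) * L by ring] at h1
      have e : S (k + 1) = S k \ (S k ∩ B k ∩ {ω | ∀ j < L, ω ∈ G (k * L + j)}) := by
        ext ω
        simp only [S, mem_ofPred_eq, Set.mem_sdiff, mem_inter_iff, Nat.forall_lt_succ_right]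
        tauto
      have hS' := hmono (Nat.mul_le_mul_right L (Nat.le_succ k)) _ hS
      refine ⟨e ▸ hS'.diff h1, ?_⟩
      have h3 := measure_sdiff_add_inter (μ := P) (S k) (hle _ _ h1)
      rw [← e, inter_eq_right.2 (inter_subset_left.trans inter_subset_left)] at h3
      rw [← h3]
      gcongr
    have hS : ∀ k, MeasurableSet[ℱ (k * L)] (S k) := by
      intro k
      induction k with
      | zero => simp [S]
      | succ k ih => exact (hstep k ih).1
    have hEae : P Eᶜ ≤ P (⋂ k, S k) := by
      refine measure_mono_ae ?_
      filter_upwards [hL] with ω hω hωE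
      refine mem_iInter.2 fun k i _ hB hGi => hωE (hω _ hB hGi)
    set a : ℝ≥0∞ := P (⋂ k, S k) - M / R with ha
    have hak : ∀ k, a ≤ P (S k ∩ B k) := by
      intro k
      rw [ha, tsub_le_iff_right]
      have hmarkov : P (B k)ᶜ ≤ M / R := by
        have h1 := meas_ge_le_lintegral_div (μ := P) (f := D (k * L))
          ((hD _).mono (hle _) le_rfl).aemeasurable (ε := R) (by exact_mod_cast hR.ne') (by simp)
        refine (measure_mono fun ω hω => ?_).trans (h1.trans (by gcongr; exact hDM _))
        simp only [B, mem_compl_iff, mem_ofPred_eq, not_le] at hω ⊢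
        exact hω.le
      calc P (⋂ k, S k) ≤ P (S k) := measure_mono (iInter_subset _ k)
        _ ≤ P (S k ∩ B k) + P (S k \ B k) := measure_le_inter_add_sdiff _ _ _
        _ ≤ P (S k ∩ B k) + M / R := by
          gcongr
          exact (measure_mono fun ω hω => hω.2).trans hmarkov
    have hsum : ∀ k : ℕ, P (S k) + k * (q ^ L * a) ≤ 1 := by
      intro k
      induction k with
      | zero => simpa using prob_le_one
      | succ k ih =>
        refine le_trans ?_ ih
        calc P (S (k + 1)) + (k + 1 : ℕ) * (q ^ L * a)
            = P (S (k + 1)) + q ^ L * a + k * (q ^ L * a) := by push_cast; ring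
          _ ≤ P (S (k + 1)) + q ^ L * P (S k ∩ B k) + k * (q ^ L * a) := by
            gcongr
            exact hak k
          _ ≤ P (S k) + k * (q ^ L * a) := by
            gcongr
            exact (hstep k (hS k)).2
    have ha0 : q ^ L * a = 0 := by
      by_contra hne
      obtain ⟨k, hk⟩ := ENNReal.exists_nat_mul_gt hne ENNReal.one_ne_top
      exact absurd (le_trans le_add_self (hsum k)) (not_le.2 hk)
    rcases mul_eq_zero.1 ha0 with h | h
    · exact absurd h (pow_ne_zero _ hq0)
    · exact hEae.trans (tsub_eq_zero_iff_le.1 h)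
  have hlim : Tendsto (fun n : ℕ => M / ((n : ℝ≥0) + 1 : ℝ≥0)) atTop (𝓝 0) := by
    have h1 : Tendsto (fun n : ℕ => (((n : ℝ≥0) + 1 : ℝ≥0) : ℝ≥0∞)) atTop (𝓝 ∞) := by
      exact ENNReal.tendsto_coe_nhds_top.2 (tendsto_atTop_mono (fun n => le_self_add)
        (tendsto_natCast_atTop_atTop (R := ℝ≥0)))
    simpa using ENNReal.Tendsto.const_div (a := M) h1 (Or.inr hM)
  have hzero : P Eᶜ = 0 :=
    le_antisymm (ge_of_tendsto' hlim fun n => hbound _ (by positivity)) zero_le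
  exact mem_ae_iff.2 hzero

end Trials

/-! ### Non-exploding solutions as driven paths -/

lemma continuous_drift (d : ℕ) (h : ℝ) {p : ℝ} (hp : 1 < p) :
    Continuous (drift d h p) := by
  have hcoord : ∀ i : Fin d, Continuous fun x : State d => x i := fun i =>
    (EuclideanSpace.proj (𝕜 := ℝ) i).continuous
  have hnode : ∀ k, Continuous fun x : State d => node x k := by
    intro k
    unfold node
    split_ifs with hk
    · exact hcoord _
    · exact continuous_const
  have hreaction : Continuous (reaction p) := by
    unfold reaction
    exact ((continuous_id.max continuous_const).rpow_const fun _ => Or.inr (by linarith)).sub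
      continuous_id
  refine (PiLp.continuous_toLp 2 _).comp (continuous_pi fun i => ?_)
  have h0 := hcoord i
  have h1 := hnode 1
  have h2 := hnode (i + 1)
  have h3 := hnode (i - 1)
  have h4 := hreaction.comp h0
  split_ifs
  · fun_prop
  · exact continuous_const.mul ((h0.neg.add h3).add (continuous_const.mul h4))
  · fun_prop

/-- A path without explosion is a driven path in `ℝ^d`, starting at `u + ε W(0)`. -/
lemma isDrivenPath_of_explosionTime_eq_top {Ω : Type*} {d : ℕ} {b : State d → State d}
    (hb : Continuous b) {ε : ℝ} {u : State d} {X : ℝ≥0 → Ω → OnePoint (State d)}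
    {W : ℝ≥0 → Ω → State d} {ω : Ω} (hX : Continuous fun t => X t ω)
    (hW : Continuous fun t => W t ω)
    (heq : ∀ (n : ℕ) (t : ℝ≥0), X (localizedTime X n t ω) ω =
      ((u + (∫ s in (0 : ℝ)..(localizedTime X n t ω), b (finitePart (X s.toNNReal ω)))
        + ε • W (localizedTime X n t ω) ω : State d) : OnePoint (State d)))
    (hexp : explosionTime X ω = ∞) :
    IsDrivenPath b ε (fun t => finitePart (X t.toNNReal ω)) (fun t => W t.toNNReal ω) ∧
      finitePart (X 0 ω) = u + ε • W 0 ω := by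
  have hlt : ∀ t : ℝ≥0, ∃ n : ℕ, (t : ℝ≥0∞) < exitTime X n ω := fun t =>
    lt_iSup_iff.1 (show (t : ℝ≥0∞) < ⨆ n : ℕ, exitTime X n ω by
      rw [← explosionTime, hexp]; exact ENNReal.coe_lt_top)
  have hcoe : ∀ t : ℝ≥0, ((finitePart (X t ω) : State d) : OnePoint (State d)) = X t ω := by
    intro t
    obtain ⟨n, hn⟩ := hlt t
    have hfin : ∃ x : State d, X t ω = x := by
      by_contra! hne
      exact absurd (iInf₂_le t fun x hx => absurd hx (hne x)) (not_le.2 hn)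
    obtain ⟨x, hx⟩ := hfin
    rw [hx]
    rfl
  have hcont : Continuous fun t => finitePart (X t ω) := by
    rw [OnePoint.isOpenEmbedding_coe.isInducing.continuous_iff]
    exact hX.congr fun t => (hcoe t).symm
  have hint : ∀ t : ℝ≥0, finitePart (X t ω) =
      u + (∫ s in (0 : ℝ)..t, b (finitePart (X s.toNNReal ω))) + ε • W t ω := by
    intro t
    obtain ⟨n, hn⟩ := hlt t
    have hloc : localizedTime X n t ω = t := by
      rw [localizedTime, min_eq_left hn.le, ENNReal.toNNReal_coe]
    have h1 := heq n t
    rw [hloc, ← hcoe t] at h1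
    exact OnePoint.coe_injective h1
  have hxc : Continuous fun t : ℝ => finitePart (X t.toNNReal ω) :=
    hcont.comp continuous_real_toNNReal
  refine ⟨⟨hxc, hW.comp continuous_real_toNNReal, fun t ht => ?_⟩, by simpa using hint 0⟩
  have hderiv : HasDerivAt (fun r => u + ∫ s in (0 : ℝ)..r, b (finitePart (X s.toNNReal ω)))
      (b (finitePart (X t.toNNReal ω))) t :=
    (((hb.comp hxc).integral_hasStrictDerivAt 0 t).hasDerivAt).const_add u
  have hzz : ∀ r ∈ Ici t, finitePart (X r.toNNReal ω) - ε • W r.toNNReal ω =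
      u + ∫ s in (0 : ℝ)..r, b (finitePart (X s.toNNReal ω)) := by
    intro r hr
    rw [hint, Real.coe_toNNReal r (ht.trans hr), add_sub_cancel_right]
  exact hderiv.hasDerivWithinAt.congr hzz (hzz t self_mem_Ici)

/-! ### Control of the deficit -/

section Deficit

variable {Ω : Type*} {m : MeasurableSpace Ω} {d : ℕ} {F : Filtration ℝ≥0 m} {P : Measure Ω}
  {W : ℝ≥0 → Ω → State d}

lemma abs_sub_le_of_windowOscillation_le {ω : Ω} (hW : Continuous fun t => W t ω) {σ s a : ℝ≥0}
    (hσ : 0 < σ) (ha : windowOscillation W σ s ω ≤ a) {t : ℝ}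
    (ht : t ∈ Icc (s : ℝ) (s + (σ : ℝ) ^ 2)) (i : Fin d) :
    |W t.toNNReal ω i - W (s : ℝ).toNNReal ω i| ≤ a := by
  obtain ⟨r, rfl⟩ : ∃ r : ℝ≥0, (s : ℝ) + r = t := ⟨⟨t - s, by linarith [ht.1]⟩, add_sub_cancel _ _⟩
  have hr : r ≤ σ ^ 2 := by
    have := ht.2
    exact_mod_cast (add_le_add_iff_left _).1 this
  have hi : Continuous fun t => W t ω i := (EuclideanSpace.proj (𝕜 := ℝ) i).continuous.comp hW
  have h1 := ofReal_abs_sub_le_chainingBound (s := s) hσ hi hr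
  have h2 : chainingBound σ s (fun t => W t ω i) ≤ windowOscillation W σ s ω :=
    Finset.single_le_sum (f := fun i => chainingBound σ s (fun t => W t ω i))
      (fun _ _ => zero_le) (Finset.mem_univ i)
  have h3 := h1.trans (h2.trans ha)
  rw [← NNReal.coe_add, Real.toNNReal_coe, Real.toNNReal_coe]
  rw [← ENNReal.ofReal_coe_nnreal] at h3
  exact (ENNReal.ofReal_le_ofReal_iff a.2).1 h3

/-- A random bound for the deficit of the solution at time `n σ²`, obtained by iterating the
contraction estimate. -/
noncomputable def deficitBound (W : ℝ≥0 → Ω → State d) (σ ρ c e D₀ : ℝ≥0) : ℕ → Ω → ℝ≥0∞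
  | 0, _ => D₀
  | n + 1, ω => ρ * deficitBound W σ ρ c e D₀ n ω +
      c * (e * windowOscillation W σ (n * σ ^ 2) ω + 1)

lemma IsStandardBrownian.measurable_deficitBound (hW : IsStandardBrownian F P W)
    (σ ρ c e D₀ : ℝ≥0) (n : ℕ) :
    Measurable[F (n * σ ^ 2)] (deficitBound W σ ρ c e D₀ n) := by
  induction n with
  | zero => exact measurable_const
  | succ n ih =>
    have hst : (n : ℝ≥0) * σ ^ 2 + σ ^ 2 = ((n + 1 : ℕ) : ℝ≥0) * σ ^ 2 := by push_cast; ring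
    have h1 := hW.measurable_windowOscillation σ (n * σ ^ 2)
    rw [hst] at h1
    have h2 := ih.mono (F.mono (hst ▸ le_self_add)) le_rfl
    exact (h2.const_mul _).add (((h1.const_mul _).add_const _).const_mul _)

lemma IsStandardBrownian.exists_lintegral_deficitBound_le [IsProbabilityMeasure P]
    (hW : IsStandardBrownian F P W) {σ : ℝ≥0} (hσ : 0 < σ) {ρ : ℝ≥0} (hρ : ρ < 1)
    (c e D₀ : ℝ≥0) :
    ∃ M : ℝ≥0∞, M ≠ ∞ ∧ ∀ n, ∫⁻ ω, deficitBound W σ ρ c e D₀ n ω ∂P ≤ M := by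
  obtain ⟨B, hB⟩ : ∃ B : ℝ≥0, (B : ℝ≥0∞) = c * (e * (σ * (d * chainingConst)) + 1) := by
    refine ⟨_, ENNReal.coe_toNNReal ?_⟩
    have := chainingConst_ne_top
    have := ENNReal.natCast_ne_top d
    finiteness
  -- The bound is stable under the recursion `M ↦ ρ M + B` satisfied by the expectations.
  refine ⟨((D₀ + B / (1 - ρ) : ℝ≥0) : ℝ≥0∞), ENNReal.coe_ne_top, fun n => ?_⟩
  have hρ' : 0 < 1 - ρ := tsub_pos_of_lt hρ
  induction n with
  | zero =>
    simp only [deficitBound, lintegral_const, measure_univ, mul_one]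
    exact_mod_cast le_self_add
  | succ n ih =>
    have hm := hW.measurable_deficitBound σ ρ c e D₀ n |>.mono (F.le _) le_rfl
    have hm' := (hW.measurable_windowOscillation σ (n * σ ^ 2)).mono (F.le _) le_rfl
    have hosc := hW.setLIntegral_windowOscillation_le hσ (n * σ ^ 2)
      (A := univ) MeasurableSet.univ
    rw [Measure.restrict_univ, measure_univ, mul_one] at hosc
    have h1 : ∫⁻ ω, deficitBound W σ ρ c e D₀ (n + 1) ω ∂P ≤
        ρ * ((D₀ + B / (1 - ρ) : ℝ≥0) : ℝ≥0∞) + B := by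
      simp only [deficitBound]
      rw [lintegral_add_left (hm.const_mul _), lintegral_const_mul _ hm,
        lintegral_const_mul _ ((hm'.const_mul _).add_const _),
        lintegral_add_right _ measurable_const, lintegral_const_mul _ hm', lintegral_const,
        measure_univ, mul_one, hB]
      gcongr
    refine h1.trans ?_
    have h2 : ρ * (D₀ + B / (1 - ρ)) + B ≤ D₀ + B / (1 - ρ) := by
      have e1 : B = (1 - ρ) * (B / (1 - ρ)) := (mul_div_cancel₀ _ hρ'.ne').symm
      have e2 : ρ + (1 - ρ) = 1 := add_tsub_cancel_of_le hρ.le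
      calc ρ * (D₀ + B / (1 - ρ)) + B
          = ρ * D₀ + (ρ * (B / (1 - ρ)) + B) := by ring
        _ = ρ * D₀ + (ρ + (1 - ρ)) * (B / (1 - ρ)) := by rw [add_mul, ← e1]
        _ ≤ D₀ + B / (1 - ρ) := by
          rw [e2, one_mul]
          gcongr
          exact mul_le_of_le_one_left zero_le hρ.le
    exact_mod_cast h2

end Deficit

/-! ### Explosion -/

section Explosion

variable {Ω : Type*} {m : MeasurableSpace Ω} {d : ℕ} {F : Filtration ℝ≥0 m} {P : Measure Ω}
  {W : ℝ≥0 → Ω → State d}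

lemma IsStandardBrownian.ae_continuous (hW : IsStandardBrownian F P W) :
    ∀ᵐ ω ∂P, Continuous fun t => W t ω := by
  filter_upwards [ae_all_iff.2 fun i => (hW.coord_isBrownian i).cont] with ω hω
  exact (PiLp.continuous_toLp 2 _).comp (continuous_pi hω)

lemma IsStandardBrownian.ae_eval_zero (hW : IsStandardBrownian F P W) :
    ∀ᵐ ω ∂P, W 0 ω = 0 := by
  filter_upwards [ae_all_iff.2 fun i => (hW.coord_isBrownian i).eval_zero_ae_eq_zero] with ω hω
  ext i
  exact hω i

variable {h p : ℝ} {ε : ℝ≥0} {x : ℝ → State d} {ω : Ω}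

lemma abs_mul_sub_le_of_windowOscillation_le (hW : Continuous fun t => W t ω) {σ s a : ℝ≥0}
    (hσ : 0 < σ) (ha : windowOscillation W σ s ω ≤ a) :
    ∀ t ∈ Icc (s : ℝ) (s + (σ : ℝ) ^ 2), ∀ i,
      |(ε : ℝ) * (W t.toNNReal ω i - W (s : ℝ).toNNReal ω i)| ≤ ε * a := by
  intro t ht i
  rw [abs_mul, abs_of_nonneg ε.coe_nonneg]
  exact mul_le_mul_of_nonneg_left (abs_sub_le_of_windowOscillation_le hW hσ ha ht i) ε.coe_nonneg

/-- The random bounds `deficitBound` control the deficit of a driven path at the window times. -/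
lemma IsDrivenPath.neg_mul_deficitBound_le {φ : ℕ → ℝ} {κ : ℝ} {C : ℝ≥0} {σ : ℝ≥0} (hσ : 0 < σ)
    (hcontr : ∀ {x w : ℝ → State d}, IsDrivenPath (drift d h p) ε x w →
      ∀ {s η V D : ℝ}, 0 ≤ s → 0 ≤ η → 0 ≤ D →
        (∀ t ∈ Icc s (s + η), ∀ i, |ε * (w t i - w s i)| ≤ V) →
        (∀ i : Fin d, -(φ i * D) ≤ x s i) →
        ∀ i : Fin d, -(φ i * (Real.exp (-κ * η) * D + C * (V + 1))) ≤ x (s + η) i)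
    (hW : Continuous fun t => W t ω)
    (hx : IsDrivenPath (drift d h p) ε x (fun t => W t.toNNReal ω)) {D₀ : ℝ≥0}
    (h0 : ∀ i : Fin d, -(φ i * D₀) ≤ x 0 i) {ρ : ℝ≥0} (hρ0 : 0 < ρ)
    (hρ : (ρ : ℝ) = Real.exp (-κ * (σ : ℝ) ^ 2)) (hC : 0 < C) (hε : 0 < ε) (n : ℕ) {R : ℝ≥0}
    (hR : deficitBound W σ ρ C ε D₀ n ω = R) (i : Fin d) :
    -(φ i * R) ≤ x (n * (σ : ℝ) ^ 2) i := by
  induction n generalizing R i with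
  | zero =>
    simp only [deficitBound, ENNReal.coe_inj] at hR
    simpa [← hR] using h0 i
  | succ n ih =>
    simp only [deficitBound] at hR
    have hfin : (ρ : ℝ≥0∞) * deficitBound W σ ρ C ε D₀ n ω +
        C * (ε * windowOscillation W σ (n * σ ^ 2) ω + 1) ≠ ∞ := hR ▸ ENNReal.coe_ne_top
    obtain ⟨hf1, hf2⟩ := ENNReal.add_ne_top.1 hfin
    have hD : deficitBound W σ ρ C ε D₀ n ω ≠ ∞ := fun hD => hf1 (by
      rw [hD, ENNReal.mul_top (by exact_mod_cast hρ0.ne')])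
    have hO : windowOscillation W σ (n * σ ^ 2) ω ≠ ∞ := fun hO => hf2 (by
      rw [hO, ENNReal.mul_top (by exact_mod_cast hε.ne'), top_add,
        ENNReal.mul_top (by exact_mod_cast hC.ne')])
    obtain ⟨D, hD'⟩ : ∃ D : ℝ≥0, (D : ℝ≥0∞) = _ := ⟨_, ENNReal.coe_toNNReal hD⟩
    obtain ⟨a, ha⟩ : ∃ a : ℝ≥0, (a : ℝ≥0∞) = _ := ⟨_, ENNReal.coe_toNNReal hO⟩
    rw [← hD', ← ha] at hR
    have hR' : ρ * D + C * (ε * a + 1) = R := by exact_mod_cast hR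
    have hosc := abs_mul_sub_le_of_windowOscillation_le (ε := ε) hW hσ ha.ge
    push_cast at hosc
    have := hcontr hx (s := n * (σ : ℝ) ^ 2) (η := (σ : ℝ) ^ 2) (V := ε * a) (D := D)
      (by positivity) (by positivity) D.coe_nonneg (fun t ht i => hosc t ht i)
      (fun i => ih hD'.symm i) i
    rw [← hR']
    push_cast
    rw [hρ, show ((n : ℝ) + 1) * (σ : ℝ) ^ 2 = n * (σ : ℝ) ^ 2 + (σ : ℝ) ^ 2 by ring]
    exact this

/-- On a good window all coordinates of a driven path gain a fixed amount, if the window is so short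
that the loss through the drift is at most half of the gain through the noise. -/
lemma IsDrivenPath.add_le_of_mem_goodWindow (hd : 2 ≤ d) (hh : 0 < h) (hp : 1 < p) {lam σ : ℝ≥0}
    (hσ : 0 < σ)
    (hshort : (4 * (ε * (lam * σ)) / h ^ 2 + 2 / h + 1) * (σ : ℝ) ^ 2 ≤ ε * σ / 2)
    (hW : Continuous fun t => W t ω)
    (hx : IsDrivenPath (drift d h p) ε x (fun t => W t.toNNReal ω)) {s : ℝ≥0}
    (hgood : ω ∈ goodWindow W lam σ s) {r : ℝ} (hr : ∀ i, r ≤ x s i) (i : Fin d) :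
    r + ε * σ / 2 ≤ x (s + (σ : ℝ) ^ 2) i := by
  have hosc := abs_mul_sub_le_of_windowOscillation_le (ε := ε) (a := lam * σ) hW hσ
    (by exact_mod_cast hgood.2)
  push_cast at hosc
  have h1 := hx.sub_mul_add_le hd hh hp s.coe_nonneg hosc hr ((s : ℝ) + (σ : ℝ) ^ 2)
    ⟨by simp, le_rfl⟩ i
  have h2 := hgood.1 i
  have e1 : ((s : ℝ) + (σ : ℝ) ^ 2).toNNReal = s + σ ^ 2 := by
    rw [← NNReal.coe_pow, ← NNReal.coe_add, Real.toNNReal_coe]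
  have e2 : (s : ℝ).toNNReal = s := Real.toNNReal_coe
  rw [add_sub_cancel_left] at h1
  simp only [e1, e2] at h1
  have h3 := mul_le_mul_of_nonneg_left h2 ε.coe_nonneg
  linarith

theorem IsSolutionUpToExplosion.ae_explosionTime_lt_top [IsProbabilityMeasure P] (hd : 2 ≤ d)
    (hh : 0 < h) (hp : 1 < p) (hW : IsStandardBrownian F P W) (hε : 0 < ε) {u : State d}
    {X : ℝ≥0 → Ω → OnePoint (State d)}
    (hX : IsSolutionUpToExplosion F P W (drift d h p) ε u X) :
    ∀ᵐ ω ∂P, explosionTime X ω < ∞ := by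
  obtain ⟨φ, κ, C, hκ, hC, hφ, hcontr⟩ := exists_contraction hd hh
  lift C to ℝ≥0 using hC.le
  obtain ⟨lam, q, hq0, hq⟩ := hW.exists_le_measure_goodWindow
  obtain ⟨σ, hσ, hshort⟩ : ∃ σ : ℝ≥0, 0 < σ ∧
      (4 * (ε * (lam * σ)) / h ^ 2 + 2 / h + 1) * (σ : ℝ) ^ 2 ≤ ε * σ / 2 := by
    have hε' : (0 : ℝ) < ε := hε
    set B : ℝ := 4 * (ε * lam) / h ^ 2 + 2 / h + 1 with hB
    have hB0 : 0 < B := by positivity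
    have hσ0 : 0 < min 1 (ε / (2 * B)) := by positivity
    refine ⟨⟨min 1 (ε / (2 * B)), hσ0.le⟩, hσ0, ?_⟩
    change (4 * (ε * (lam * min 1 (ε / (2 * B)))) / h ^ 2 + 2 / h + 1) *
      (min 1 (ε / (2 * B))) ^ 2 ≤ ε * min 1 (ε / (2 * B)) / 2
    set t : ℝ := min 1 (ε / (2 * B))
    have ht1 : t ≤ 1 := min_le_left _ _
    have ht2 : t * (2 * B) ≤ ε := (le_div_iff₀ (by positivity)).1 (min_le_right _ _)
    have h1 : 4 * (ε * (lam * t)) / h ^ 2 + 2 / h + 1 ≤ B := by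
      rw [hB]
      gcongr
      exact mul_le_of_le_one_right lam.coe_nonneg ht1
    calc _ ≤ B * t ^ 2 := by gcongr
      _ = t * (2 * B) * t / 2 := by ring
      _ ≤ ε * t / 2 := by gcongr
  have hσ' : (0 : ℝ) < σ := hσ
  -- The contraction factor over one window.
  set ρ : ℝ≥0 := ⟨Real.exp (-κ * (σ : ℝ) ^ 2), (Real.exp_pos _).le⟩ with hρ
  have hρ0 : 0 < ρ := Real.exp_pos _
  have hρ1 : ρ < 1 := by
    change Real.exp (-κ * (σ : ℝ) ^ 2) < 1
    rw [Real.exp_lt_one_iff]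
    have : 0 < κ * (σ : ℝ) ^ 2 := by positivity
    linarith
  -- `φ ≥ 1 / 2`, whence the factor `2`.
  set D₀ : ℝ≥0 := 2 * ‖u‖₊ with hD₀
  obtain ⟨M, hM, hDM⟩ := hW.exists_lintegral_deficitBound_le hσ hρ1 C ε D₀
  have hst : ∀ n : ℕ, (n : ℝ≥0) * σ ^ 2 + σ ^ 2 = ((n + 1 : ℕ) : ℝ≥0) * σ ^ 2 := fun n => by
    push_cast
    ring
  refine ae_mem_of_trials (ℱ := fun n => F (n * σ ^ 2))
    (G := fun n => goodWindow W lam σ (n * σ ^ 2)) (q := q)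
    (D := deficitBound W σ ρ C ε D₀) (E := {ω | explosionTime X ω < ∞})
    (fun i j hij => F.mono (by gcongr)) (fun n => F.le _) (fun n => ?_) hq0.ne'
    (fun n A hA => hq σ hσ _ A hA) (fun n => hW.measurable_deficitBound σ ρ C ε D₀ n) hM hDM ?_
  · rw [← hst n]
    exact hW.measurableSet_goodWindow lam σ (n * σ ^ 2)
  intro R
  obtain ⟨K, hK⟩ := exists_blowup_level (p := p) hd hh hp (η := (σ : ℝ) ^ 2) (by positivity)
    (ε * (lam * σ))
  -- `N` good windows lift the path from `-R` to `K`; during one more the path blows up.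
  obtain ⟨N, hN⟩ := exists_nat_ge ((K + R) / (ε * σ / 2))
  have hθ : (0 : ℝ) < ε * σ / 2 := by
    have hε' : (0 : ℝ) < ε := hε
    positivity
  rw [div_le_iff₀ hθ] at hN
  refine ⟨N + 1, ?_⟩
  filter_upwards [hX.continuous_paths, ae_all_iff.2 hX.integral_eq, hW.ae_continuous,
    hW.ae_eval_zero] with ω hXc hXeq hWc hW0 n hn hgood
  by_contra hexp
  have hexp' : explosionTime X ω = ∞ := not_lt_top_iff.1 hexp
  obtain ⟨hx, hx0⟩ := isDrivenPath_of_explosionTime_eq_top (continuous_drift d h hp) hXc hWc hXeq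
    hexp'
  set x : ℝ → State d := fun t => finitePart (X t.toNNReal ω) with hxdef
  have hinit : ∀ i : Fin d, -(φ i * D₀) ≤ x 0 i := by
    intro i
    have e : x 0 = u := by
      simp only [hxdef, Real.toNNReal_zero]
      rw [hx0, hW0, smul_zero, add_zero]
    have h1 := (abs_le.1 (PiLp.norm_apply_le u i)).1
    have h2 := mul_le_mul_of_nonneg_right (hφ i i.2).1 (norm_nonneg u)
    rw [e, hD₀]
    push_cast
    linarith
  have hstart : ∀ i, -(R : ℝ) ≤ x (n * (σ : ℝ) ^ 2) i := by
    intro i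
    obtain ⟨R', hR'⟩ : ∃ R' : ℝ≥0, (R' : ℝ≥0∞) = deficitBound W σ ρ C ε D₀ n ω :=
      ⟨_, ENNReal.coe_toNNReal (hn.trans_lt ENNReal.coe_lt_top).ne⟩
    have h1 := hx.neg_mul_deficitBound_le hσ (fun hx => hcontr hx) hWc hinit hρ0 rfl hC hε n
      hR'.symm i
    rw [← hR'] at hn
    have h2 : (R' : ℝ) ≤ R := by exact_mod_cast hn
    have h3 := mul_le_mul_of_nonneg_right (hφ i i.2).2 R'.coe_nonneg
    linarith
  have hclimb : ∀ j ≤ N, ∀ i, -(R : ℝ) + j * (ε * σ / 2) ≤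
      x (((n + j : ℕ) : ℝ) * (σ : ℝ) ^ 2) i := by
    intro j
    induction j with
    | zero => simpa using hstart
    | succ j ih =>
      intro hj i
      have h1 := hx.add_le_of_mem_goodWindow hd hh hp hσ hshort hWc
        (hgood j (by omega)) (r := -(R : ℝ) + j * (ε * σ / 2)) (fun i => by
          have := ih (by omega) i
          push_cast at this ⊢
          exact this) i
      push_cast at h1 ⊢
      rw [show ((n : ℝ) + (j + 1)) * (σ : ℝ) ^ 2 = (n + j) * (σ : ℝ) ^ 2 + (σ : ℝ) ^ 2 by ring]
      linarith
  have hlast := hgood N (by omega)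
  have hosc := abs_mul_sub_le_of_windowOscillation_le (ε := ε) (a := lam * σ) hWc hσ
    (by exact_mod_cast hlast.2)
  push_cast at hosc
  refine hK hx (s := ((n : ℝ) + N) * (σ : ℝ) ^ 2) (by positivity) hosc fun i => ?_
  have := hclimb N le_rfl i
  push_cast at this
  linarith

lemma drift_zero (d : ℕ) (h : ℝ) {p : ℝ} (hp : 1 < p) : drift d h p 0 = 0 := by
  have hp0 : p ≠ 0 := by linarith
  ext i
  simp [drift, node, reaction, Real.zero_rpow hp0]

end Explosion

end BlowUpSDE

theorem theorem2p3 (d : ℕ) (hd : 2 ≤ d) (h p : ℝ) (hh : 0 < h) (hp : 1 < p) :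
    (∀ (Ω : Type*) (m : MeasurableSpace Ω) (P : Measure Ω) (_ : IsProbabilityMeasure P)
      (F : Filtration ℝ≥0 m) (W : ℝ≥0 → Ω → BlowUpSDE.State d)
      (_ : BlowUpSDE.UsualConditions F P) (_ : BlowUpSDE.IsStandardBrownian F P W)
      (ε : ℝ) (_ : 0 < ε) (u : BlowUpSDE.State d)
      (X : ℝ≥0 → Ω → OnePoint (BlowUpSDE.State d))
      (_ : BlowUpSDE.IsSolutionUpToExplosion F P W (BlowUpSDE.drift d h p) ε u X),
      ∀ᵐ ω ∂P, BlowUpSDE.explosionTime X ω < ∞) ∧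
    (∃ U : ℝ → BlowUpSDE.State d,
      BlowUpSDE.IsGlobalODESolution (BlowUpSDE.drift d h p) U) := by
  refine ⟨fun Ω m P _ F W _ hW ε hε u X hX => ?_, fun _ => 0, fun t _ => ?_⟩
  · lift ε to ℝ≥0 using hε.le
    exact hX.ae_explosionTime_lt_top hd hh hp hW hε
  · rw [BlowUpSDE.drift_zero d h hp]
    exact hasDerivWithinAt_const t _ _
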